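/- **Setting.** Let $A$ be a $C^*$-algebra (not necessarily unital) and $J\vartriangleleft A$ a closed two-sided ideal. For a Hilbert space $\mathcal H$ let $\mathbb B(\mathcal H)$ and $\mathbb K(\mathcal H)$ be the bounded and the compact operators. An *even higher-order relative spectral triple* $(\mathcal J\vartriangleleft\mathcal A,\mathcal H,\mathcal D)$ of order $m>0$ for $J\vartriangleleft A$ consists of a $\mathbb Z/2$-graded separable Hilbert space $\mathcal H$, an even $*$-representation $\rho\colon A\to\mathbb B(\mathcal H)$, a dense $*$-subalgebra $\mathcal A\subseteq A$, a $*$-subalgebra $\mathcal J\subseteq J\cap\mathcal A$ that is dense in $J$, and an odd, symmetric, closed, densely defined operator $\mathcal D$ on $\mathcal H$ such that 1. $\rho(a)\operatorname{dom}\mathcal D\subseteq\operatorname{dom}\mathcal D$ for all $a\in\mathcal A$; 2. $\rho(j)\operatorname{dom}\mathcal D^*\subseteq\operatorname{dom}\mathcal D$ for all $j\in\mathcal J$; 3. $\rho(j)(1+\mathcal D^*\mathcal D)^{-1/2}\in\mathbb K(\mathcal H)$ for all $j\in\mathcal J$; 4. $[\mathcal D,\rho(a)](1+\mathcal D^*\mathcal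 D)^{-1/2}\in\mathbb K(\mathcal H)$ for all $a\in\mathcal A$; 5. $[\mathcal D,\rho(a)](1+\mathcal D^*\mathcal D)^{-\frac12+\frac1{2m}}$ extends to an element of $\mathbb B(\mathcal H)$ for all $a\in\mathcal A$. An *odd* one is defined in the same way, with $\mathcal H$ trivially graded and $\mathcal D$ not required to be odd. An *even relative $K$-cycle* for $J\vartriangleleft A$ is a triple $(\rho,\mathcal H,F)$ of a $\mathbb Z/2$-graded separable Hilbert space $\mathcal H$, an even $*$-representation $\rho\colon A\to\mathbb B(\mathcal H)$ and an odd operator $F\in\mathbb B(\mathcal H)$ such that $\rho(j)(F-F^*)$, $\rho(j)(1-F^2)$ and $[F,\rho(a)]$ are in $\mathbb K(\mathcal H)$ for all $j\in J$, $a\in A$; it is *degenerate* if these operators are all zero. An *odd* relative $K$-cycle has $\mathcal H$ trivially graded and $F$ not required to be odd. Two relative $K$-cycles $x,y$ of the same parity are equivalent if there are degenerate $x',y'$ and a norm-continuous path $(F_t)_{t\in[0,1]}$, with each $(\rho,\mathcal H,F_t)$ a relative $K$-cycle of that parity, such that $x\oplus x'$ is unitarily equivalent to $(\rho,\mathcal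 H,F_0)$ and $y\oplus y'$ to $(\rho,\mathcal H,F_1)$, through even unitaries. The set of equivalence classes is $K^0(J\vartriangleleft A)$ in the even case and $K^1(J\vartriangleleft A)$ in the odd case, both written $K^*(J\vartriangleleft A)$. **Theorem.** Let $(\mathcal J\vartriangleleft\mathcal A,\mathcal H,\mathcal D)$ be an even or odd higher-order relative spectral triple of some order $m>0$ for $J\vartriangleleft A$, with representation $\rho$. Then the bounded transform $F=\mathcal D(1+\mathcal D^*\mathcal D)^{-1/2}$ is an everywhere defined bounded operator on $\mathcal H$, and $$\rho(j)(F-F^*),\qquad \rho(j)(1-F^2),\qquad [F,\rho(a)]$$ are compact for all $j\in J$ and $a\in A$. Hence $(\rho,\mathcal H,F)$ is a relative $K$-cycle for $J\vartriangleleft A$ of the same parity, and it defines a class $[\mathcal D]\in K^*(J\vartriangleleft A)$. -/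

import Mathlib

open scoped InnerProductSpace

set_option linter.unusedSectionVars false

noncomputable section

namespace RelKHom

universe u v

section UnboundedOperators

variable {H : Type v} [NormedAddCommGroup H] [InnerProductSpace ℂ H]

/-- The product `S T` of two unbounded operators, with its maximal domain
`{x ∈ dom T | T x ∈ dom S}`. -/
def opMul (S T : H →ₗ.[ℂ] H) : H →ₗ.[ℂ] H where
  domain :=
    { carrier := {x | ∃ hx : x ∈ T.domain, T ⟨x, hx⟩ ∈ S.domain}
      zero_mem' := ⟨T.domain.zero_mem, by
        have : T ⟨0, T.domain.zero_mem⟩ = 0 := T.map_zero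
        rw [this]; exact S.domain.zero_mem⟩
      add_mem' := by
        rintro x y ⟨hx, hx'⟩ ⟨hy, hy'⟩
        refine ⟨T.domain.add_mem hx hy, ?_⟩
        have : T ⟨x + y, T.domain.add_mem hx hy⟩ = T ⟨x, hx⟩ + T ⟨y, hy⟩ :=
          T.map_add ⟨x, hx⟩ ⟨y, hy⟩
        rw [this]; exact S.domain.add_mem hx' hy'
      smul_mem' := by
        rintro c x ⟨hx, hx'⟩
        refine ⟨T.domain.smul_mem c hx, ?_⟩
        have : T ⟨c • x, T.domain.smul_mem c hx⟩ = c • T ⟨x, hx⟩ := T.map_smul c ⟨x, hx⟩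
        rw [this]; exact S.domain.smul_mem c hx' }
  toFun :=
    { toFun := fun x => S ⟨T ⟨x.1, x.2.1⟩, x.2.2⟩
      map_add' := by
        rintro ⟨x, hx, hx'⟩ ⟨y, hy, hy'⟩
        rw [← S.map_add]
        congr 1
        exact Subtype.ext (T.map_add ⟨x, hx⟩ ⟨y, hy⟩)
      map_smul' := by
        rintro c ⟨x, hx, hx'⟩
        rw [RingHom.id_apply, ← S.map_smul]
        congr 1
        exact Subtype.ext (T.map_smul c ⟨x, hx⟩) }

/-- A bounded operator, viewed as an (everywhere defined) unbounded operator. -/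
def ofBounded (T : H →L[ℂ] H) : H →ₗ.[ℂ] H := (T : H →ₗ[ℂ] H).toPMap ⊤

/-- The commutator `[D, a] = D a - a D` of an unbounded operator with a bounded one, defined on
`{x ∈ dom D | a x ∈ dom D}`. -/
def opCommutator (D : H →ₗ.[ℂ] H) (a : H →L[ℂ] H) : H →ₗ.[ℂ] H :=
  opMul D (ofBounded a) - opMul (ofBounded a) D

/-- `T ∈ 𝕂(H)`: the operator `T` is everywhere defined, bounded and compact. -/
def IsCompactOp (T : H →ₗ.[ℂ] H) : Prop :=
  ∃ K : H →L[ℂ] H, IsCompactOperator K ∧ T = ofBounded K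

/-- `T` extends to an element of `𝔹(H)`. -/
def HasBoundedExtension (T : H →ₗ.[ℂ] H) : Prop :=
  ∃ B : H →L[ℂ] H, T ≤ ofBounded B

variable [CompleteSpace H]

/-- The operator `1 + D* D`, with domain `{x ∈ dom D | D x ∈ dom D*}`. -/
def oneAddSq (D : H →ₗ.[ℂ] H) : H →ₗ.[ℂ] H :=
  ofBounded 1 + opMul D.adjoint D

/-- The (closure of the) graph of `D` in the Hilbert space `H ⊕ H`. For closed `D` this is `dom D`
with the graph norm. -/
def graphSpace (D : H →ₗ.[ℂ] H) : Submodule ℂ (WithLp 2 (H × H)) :=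
  (D.graph.comap (WithLp.linearEquiv 2 ℂ (H × H)).toLinearMap).topologicalClosure

instance (D : H →ₗ.[ℂ] H) : CompleteSpace (graphSpace D) :=
  (Submodule.isClosed_topologicalClosure _).completeSpace_coe

/-- The inclusion `dom D → H`, bounded for the graph norm on `dom D`. -/
def graphIncl (D : H →ₗ.[ℂ] H) : graphSpace D →L[ℂ] H :=
  (ContinuousLinearMap.fst ℂ H H) ∘L
    (WithLp.prodContinuousLinearEquiv 2 ℂ H H : WithLp 2 (H × H) →L[ℂ] H × H) ∘L
      (graphSpace D).subtypeL

/-- The bounded operator `(1 + D* D)⁻¹`, for closed densely defined `D`, constructed as `ι ι*` with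
`ι : dom D → H` the inclusion. See `oneAddSqInv_inverse` for the proof that it is the inverse. -/
def oneAddSqInv (D : H →ₗ.[ℂ] H) : H →L[ℂ] H :=
  graphIncl D ∘L (ContinuousLinearMap.adjoint (graphIncl D))

theorem oneAddSqInv_nonneg (D : H →ₗ.[ℂ] H) : 0 ≤ oneAddSqInv D := by
  rw [ContinuousLinearMap.nonneg_iff_isPositive]
  exact ContinuousLinearMap.isPositive_self_comp_adjoint _

/-- The real power `(1 + D* D)ˢ`: for `s ≤ 0` it is the bounded operator `((1 + D* D)⁻¹)⁻ˢ`, given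
by the continuous functional calculus of the positive bounded operator `(1 + D* D)⁻¹`; for `s > 0`
it is the (in general unbounded) inverse of the injective bounded operator `(1 + D* D)⁻ˢ`. -/
def oneAddSqPow (D : H →ₗ.[ℂ] H) (s : ℝ) : H →ₗ.[ℂ] H :=
  if s ≤ 0 then ofBounded (oneAddSqInv D ^ (-s)) else (ofBounded (oneAddSqInv D ^ s)).inverse

theorem mem_graphSpace {D : H →ₗ.[ℂ] H} (hc : D.IsClosed) (g : WithLp 2 (H × H)) :
    g ∈ graphSpace D ↔ (g.fst, g.snd) ∈ D.graph := by
  have hcl : IsClosed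
      ((D.graph.comap (WithLp.linearEquiv 2 ℂ (H × H)).toLinearMap : Submodule ℂ _) :
        Set (WithLp 2 (H × H))) :=
    IsClosed.preimage (WithLp.prodContinuousLinearEquiv 2 ℂ H H).continuous hc
  unfold graphSpace
  rw [hcl.submodule_topologicalClosure_eq]
  rfl

theorem oneAddSq_graph {D : H →ₗ.[ℂ] H} (hc : D.IsClosed) (hd : Dense (D.domain : Set H))
    (x y : H) : (x, y) ∈ (oneAddSq D).graph ↔ oneAddSqInv D y = x := by
  have key : ∀ (g : graphSpace D), (ContinuousLinearMap.adjoint (graphIncl D)) y = g ↔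
      ∀ z : D.domain, ⟪y, (z : H)⟫_ℂ = ⟪g.1.fst, (z : H)⟫_ℂ + ⟪g.1.snd, D z⟫_ℂ := by
    intro g
    rw [ext_iff_inner_right ℂ]
    constructor
    · intro h z
      have hz : WithLp.toLp 2 ((z : H), D z) ∈ graphSpace D :=
        (mem_graphSpace hc _).2 (D.mem_graph z)
      have := h ⟨_, hz⟩
      rw [ContinuousLinearMap.adjoint_inner_left] at this
      exact this
    · rintro h ⟨w, hw⟩
      obtain ⟨z, hz1, hz2⟩ := (D.mem_graph_iff).1 ((mem_graphSpace hc w).1 hw)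
      have := h z
      simp only at hz1 hz2
      rw [hz1, hz2] at this
      rw [ContinuousLinearMap.adjoint_inner_left]
      exact this
  constructor
  · intro h
    obtain ⟨z, hz1, hz2⟩ := (LinearPMap.mem_graph_iff _).1 h
    obtain ⟨z, hz0, hzD, hzA⟩ := z
    simp only at hz1 hz2
    subst hz1
    have hz2' : z + D.adjoint ⟨D ⟨z, hzD⟩, hzA⟩ = y := hz2
    have hg : WithLp.toLp 2 (z, D ⟨z, hzD⟩) ∈ graphSpace D :=
      (mem_graphSpace hc _).2 (D.mem_graph ⟨z, hzD⟩)
    have := (key ⟨_, hg⟩).2 (by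
      intro w
      rw [← hz2', inner_add_left]
      congr 1
      exact D.adjoint_isFormalAdjoint hd ⟨D ⟨z, hzD⟩, hzA⟩ w)
    show graphIncl D (ContinuousLinearMap.adjoint (graphIncl D) y) = z
    rw [this]
    rfl
  · intro h
    have hk := (key _).1 (rfl : ContinuousLinearMap.adjoint (graphIncl D) y = _)
    set g := ContinuousLinearMap.adjoint (graphIncl D) y with hgdef
    have hx : g.1.fst = x := h
    obtain ⟨z, hz1, hz2⟩ := (D.mem_graph_iff).1 ((mem_graphSpace hc g.1).1 g.2)
    simp only at hz1 hz2
    rw [← hz2, hx] at hk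
    rw [hx] at hz1
    have hw : ∀ w : D.domain, ⟪y - x, (w : H)⟫_ℂ = ⟪D z, D w⟫_ℂ := by
      intro w
      rw [inner_sub_left, hk w]; ring
    have hmem : D z ∈ D.adjoint.domain := D.mem_adjoint_domain_of_exists _ ⟨y - x, hw⟩
    have hval : D.adjoint ⟨D z, hmem⟩ = y - x := D.adjoint_apply_eq hd ⟨D z, hmem⟩ hw
    obtain ⟨z, hzD⟩ := z
    simp only at hz1
    subst hz1
    refine (LinearPMap.mem_graph_iff _).2 ⟨⟨z, trivial, hzD, hmem⟩, rfl, ?_⟩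
    show z + D.adjoint ⟨D ⟨z, hzD⟩, hmem⟩ = y
    rw [hval]; abel

/-- For closed densely defined `D`, the bounded operator `oneAddSqInv D` is the inverse of the
operator `1 + D* D`. -/
theorem oneAddSqInv_inverse {D : H →ₗ.[ℂ] H} (hc : D.IsClosed) (hd : Dense (D.domain : Set H)) :
    oneAddSq D = (ofBounded (oneAddSqInv D)).inverse := by
  have hker : LinearMap.ker (ofBounded (oneAddSqInv D)).toFun = ⊥ := by
    rw [LinearMap.ker_eq_bot']
    rintro ⟨y, hy⟩ h0
    have h0' : oneAddSqInv D y = 0 := h0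
    have := LinearPMap.graph_fst_eq_zero_snd _ ((oneAddSq_graph hc hd 0 y).2 h0') rfl
    exact Subtype.ext this
  apply LinearPMap.eq_of_eq_graph
  rw [LinearPMap.inverse_graph hker]
  ext ⟨x, y⟩
  rw [oneAddSq_graph hc hd]
  simp only [Submodule.mem_map, LinearPMap.mem_graph_iff]
  constructor
  · intro h
    exact ⟨(y, x), ⟨⟨y, trivial⟩, rfl, h⟩, rfl⟩
  · rintro ⟨⟨a, b⟩, ⟨⟨c, hc'⟩, h1, h2⟩, h3⟩
    have e1 : b = x := congrArg Prod.fst h3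
    have e2 : a = y := congrArg Prod.snd h3
    subst e1 e2
    simp only at h1
    subst h1
    exact h2

/-- The first power is `1 + D* D` itself. -/
theorem oneAddSqPow_one {D : H →ₗ.[ℂ] H} (hc : D.IsClosed) (hd : Dense (D.domain : Set H)) :
    oneAddSqPow D 1 = oneAddSq D := by
  rw [oneAddSqInv_inverse hc hd, oneAddSqPow, if_neg (by norm_num),
    CFC.rpow_one _ (oneAddSqInv_nonneg D)]

/-- The bounded transform `D (1 + D* D)^(-1/2)`, as a product of unbounded operators. -/
def boundedTransform (D : H →ₗ.[ℂ] H) : H →ₗ.[ℂ] H := opMul D (oneAddSqPow D (-(1 / 2)))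

end UnboundedOperators

/-- The parity of a spectral triple or of a `K`-cycle. -/
inductive Parity
  | even
  | odd

section Cycles

variable {A : Type u} [NonUnitalCStarAlgebra A]
variable {H : Type v} [NormedAddCommGroup H] [InnerProductSpace ℂ H] [CompleteSpace H]

/-- `γ` is the grading operator of a `ℤ/2`-grading of `H` (the homogeneous parts being the
eigenspaces `ker (γ - 1)` and `ker (γ + 1)`); in the odd case the grading is trivial. -/
structure IsGrading (p : Parity) (γ : H →L[ℂ] H) : Prop where
  selfAdjoint : IsSelfAdjoint γ
  sq : γ * γ = 1
  trivial_of_odd : p = Parity.odd → γ = 1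

/-- `(𝒥 ◁ 𝒜, H, D)` is a higher-order relative spectral triple of order `m` for `J ◁ A`, with
representation `ρ` and grading operator `γ`; even or odd according to `p`. -/
structure IsHigherOrderRelativeSpectralTriple (p : Parity) (m : ℝ) (J : TwoSidedIdeal A)
    (𝒥 𝒜 : NonUnitalStarSubalgebra ℂ A) (γ : H →L[ℂ] H) (ρ : A →⋆ₙₐ[ℂ] (H →L[ℂ] H))
    (D : H →ₗ.[ℂ] H) : Prop where
  order_pos : 0 < m
  grading : IsGrading p γ
  rep_even : ∀ a : A, γ * ρ a = ρ a * γ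
  dense_𝒜 : Dense (𝒜 : Set A)
  𝒥_le_𝒜 : 𝒥 ≤ 𝒜
  𝒥_subset_J : (𝒥 : Set A) ⊆ J
  dense_𝒥 : (J : Set A) ⊆ closure (𝒥 : Set A)
  dense_domain : Dense (D.domain : Set H)
  closed : D.IsClosed
  symmetric : D.IsFormalAdjoint D
  odd : p = Parity.even →
    ∀ x : D.domain, ∃ hx : γ x ∈ D.domain, D ⟨γ x, hx⟩ = -γ (D x)
  rep_domain : ∀ a ∈ 𝒜, ∀ x ∈ D.domain, ρ a x ∈ D.domain
  rep_adjoint_domain : ∀ j ∈ 𝒥, ∀ x ∈ D.adjoint.domain, ρ j x ∈ D.domain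
  compact_resolvent : ∀ j ∈ 𝒥,
    IsCompactOp (opMul (ofBounded (ρ j)) (oneAddSqPow D (-(1 / 2))))
  compact_commutator : ∀ a ∈ 𝒜,
    IsCompactOp (opMul (opCommutator D (ρ a)) (oneAddSqPow D (-(1 / 2))))
  bounded_commutator : ∀ a ∈ 𝒜,
    HasBoundedExtension (opMul (opCommutator D (ρ a)) (oneAddSqPow D (-(1 / 2) + 1 / (2 * m))))

/-- `(ρ, H, F)` is a relative `K`-cycle for `J ◁ A`, with grading operator `γ`. -/
structure IsRelativeKCycle (p : Parity) (J : TwoSidedIdeal A) (γ : H →L[ℂ] H)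
    (ρ : A →⋆ₙₐ[ℂ] (H →L[ℂ] H)) (F : H →L[ℂ] H) : Prop where
  grading : IsGrading p γ
  rep_even : ∀ a : A, γ * ρ a = ρ a * γ
  odd : p = Parity.even → F * γ = -(γ * F)
  compact_selfAdjoint : ∀ j ∈ J, IsCompactOperator (ρ j * (F - star F) : H →L[ℂ] H)
  compact_sq : ∀ j ∈ J, IsCompactOperator (ρ j * (1 - F * F) : H →L[ℂ] H)
  compact_commutator : ∀ a : A, IsCompactOperator (F * ρ a - ρ a * F : H →L[ℂ] H)

end Cycles

section KHomology

variable {A : Type u} [NonUnitalCStarAlgebra A]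

/-- The relative `K`-cycles of parity `p` for `J ◁ A`, on separable Hilbert spaces. -/
structure RelativeKCycle (p : Parity) (J : TwoSidedIdeal A) where
  H : Type v
  [instNormed : NormedAddCommGroup H]
  [instInner : InnerProductSpace ℂ H]
  [instComplete : CompleteSpace H]
  [instSeparable : TopologicalSpace.SeparableSpace H]
  γ : H →L[ℂ] H
  ρ : A →⋆ₙₐ[ℂ] (H →L[ℂ] H)
  F : H →L[ℂ] H
  isCycle : IsRelativeKCycle p J γ ρ F

attribute [instance] RelativeKCycle.instNormed RelativeKCycle.instInner
  RelativeKCycle.instComplete RelativeKCycle.instSeparable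

/-- The relative `K`-cycle `(ρ, H, F)`. -/
def IsRelativeKCycle.toCycle {H : Type v} [NormedAddCommGroup H] [InnerProductSpace ℂ H]
    [CompleteSpace H] [TopologicalSpace.SeparableSpace H] {p : Parity} {J : TwoSidedIdeal A}
    {γ : H →L[ℂ] H} {ρ : A →⋆ₙₐ[ℂ] (H →L[ℂ] H)} {F : H →L[ℂ] H}
    (h : IsRelativeKCycle p J γ ρ F) : RelativeKCycle.{u, v} p J where
  H := H
  γ := γ
  ρ := ρ
  F := F
  isCycle := h

section DirectSum

variable {H₁ H₂ : Type v} [NormedAddCommGroup H₁] [InnerProductSpace ℂ H₁] [CompleteSpace H₁]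
  [NormedAddCommGroup H₂] [InnerProductSpace ℂ H₂] [CompleteSpace H₂]

/-- The direct sum `S ⊕ T` on the Hilbert space direct sum `H₁ ⊕ H₂`. -/
def opSum (S : H₁ →L[ℂ] H₁) (T : H₂ →L[ℂ] H₂) :
    WithLp 2 (H₁ × H₂) →L[ℂ] WithLp 2 (H₁ × H₂) :=
  ((WithLp.prodContinuousLinearEquiv 2 ℂ H₁ H₂).symm : H₁ × H₂ →L[ℂ] WithLp 2 (H₁ × H₂)) ∘L
    (S.prodMap T) ∘L
      (WithLp.prodContinuousLinearEquiv 2 ℂ H₁ H₂ : WithLp 2 (H₁ × H₂) →L[ℂ] H₁ × H₂)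

theorem opSum_apply (S : H₁ →L[ℂ] H₁) (T : H₂ →L[ℂ] H₂) (x : WithLp 2 (H₁ × H₂)) :
    opSum S T x = WithLp.toLp 2 (S x.fst, T x.snd) := rfl

theorem opSum_mul (S S' : H₁ →L[ℂ] H₁) (T T' : H₂ →L[ℂ] H₂) :
    opSum S T * opSum S' T' = opSum (S * S') (T * T') := rfl

theorem opSum_one : opSum (1 : H₁ →L[ℂ] H₁) (1 : H₂ →L[ℂ] H₂) = 1 := rfl

theorem opSum_sub (S S' : H₁ →L[ℂ] H₁) (T T' : H₂ →L[ℂ] H₂) :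
    opSum S T - opSum S' T' = opSum (S - S') (T - T') := rfl

theorem opSum_neg (S : H₁ →L[ℂ] H₁) (T : H₂ →L[ℂ] H₂) : -opSum S T = opSum (-S) (-T) := rfl

theorem opSum_star (S : H₁ →L[ℂ] H₁) (T : H₂ →L[ℂ] H₂) :
    star (opSum S T) = opSum (star S) (star T) := by
  symm
  rw [ContinuousLinearMap.star_eq_adjoint (opSum S T), ContinuousLinearMap.eq_adjoint_iff]
  intro x y
  simp only [opSum_apply, WithLp.prod_inner_apply, ContinuousLinearMap.star_eq_adjoint,
    ContinuousLinearMap.adjoint_inner_left]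
  rfl

theorem opSum_compact {S : H₁ →L[ℂ] H₁} {T : H₂ →L[ℂ] H₂} (hS : IsCompactOperator S)
    (hT : IsCompactOperator T) : IsCompactOperator (opSum S T) := by
  have h : (opSum S T : WithLp 2 (H₁ × H₂) → WithLp 2 (H₁ × H₂)) =
      (fun x => ((WithLp.prodContinuousLinearEquiv 2 ℂ H₁ H₂).symm : H₁ × H₂ →L[ℂ] _)
        (ContinuousLinearMap.inl ℂ H₁ H₂ (S ((ContinuousLinearMap.fst ℂ H₁ H₂ ∘L
          (WithLp.prodContinuousLinearEquiv 2 ℂ H₁ H₂ : _ →L[ℂ] H₁ × H₂)) x)))) +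
      (fun x => ((WithLp.prodContinuousLinearEquiv 2 ℂ H₁ H₂).symm : H₁ × H₂ →L[ℂ] _)
        (ContinuousLinearMap.inr ℂ H₁ H₂ (T ((ContinuousLinearMap.snd ℂ H₁ H₂ ∘L
          (WithLp.prodContinuousLinearEquiv 2 ℂ H₁ H₂ : _ →L[ℂ] H₁ × H₂)) x)))) := by
    funext x
    apply (WithLp.prodContinuousLinearEquiv 2 ℂ H₁ H₂).injective
    ext <;> simp [opSum]
  rw [h]
  exact (((hS.comp_clm _).clm_comp _).clm_comp _).add (((hT.comp_clm _).clm_comp _).clm_comp _)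

/-- The direct sum of two representations. -/
def repSum (ρ₁ : A →⋆ₙₐ[ℂ] (H₁ →L[ℂ] H₁)) (ρ₂ : A →⋆ₙₐ[ℂ] (H₂ →L[ℂ] H₂)) :
    A →⋆ₙₐ[ℂ] (WithLp 2 (H₁ × H₂) →L[ℂ] WithLp 2 (H₁ × H₂)) where
  toFun a := opSum (ρ₁ a) (ρ₂ a)
  map_smul' c a := by simp only [map_smul]; rfl
  map_zero' := by simp only [map_zero]; rfl
  map_add' a b := by simp only [map_add]; rfl
  map_mul' a b := by rw [map_mul, map_mul, opSum_mul]
  map_star' a := by rw [map_star, map_star, opSum_star]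

theorem repSum_apply (ρ₁ : A →⋆ₙₐ[ℂ] (H₁ →L[ℂ] H₁)) (ρ₂ : A →⋆ₙₐ[ℂ] (H₂ →L[ℂ] H₂)) (a : A) :
    repSum ρ₁ ρ₂ a = opSum (ρ₁ a) (ρ₂ a) := rfl

theorem IsRelativeKCycle.sum {p : Parity} {J : TwoSidedIdeal A}
    {γ₁ : H₁ →L[ℂ] H₁} {ρ₁ : A →⋆ₙₐ[ℂ] (H₁ →L[ℂ] H₁)} {F₁ : H₁ →L[ℂ] H₁}
    {γ₂ : H₂ →L[ℂ] H₂} {ρ₂ : A →⋆ₙₐ[ℂ] (H₂ →L[ℂ] H₂)} {F₂ : H₂ →L[ℂ] H₂}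
    (h₁ : IsRelativeKCycle p J γ₁ ρ₁ F₁) (h₂ : IsRelativeKCycle p J γ₂ ρ₂ F₂) :
    IsRelativeKCycle p J (opSum γ₁ γ₂) (repSum ρ₁ ρ₂) (opSum F₁ F₂) where
  grading :=
    { selfAdjoint := by
        rw [IsSelfAdjoint, opSum_star, h₁.grading.selfAdjoint.star_eq,
          h₂.grading.selfAdjoint.star_eq]
      sq := by rw [opSum_mul, h₁.grading.sq, h₂.grading.sq, opSum_one]
      trivial_of_odd := fun hp => by
        rw [h₁.grading.trivial_of_odd hp, h₂.grading.trivial_of_odd hp, opSum_one] }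
  rep_even a := by
    rw [repSum_apply, opSum_mul, opSum_mul, h₁.rep_even, h₂.rep_even]
  odd hp := by rw [opSum_mul, opSum_mul, h₁.odd hp, h₂.odd hp, opSum_neg]
  compact_selfAdjoint j hj := by
    rw [repSum_apply, opSum_star, opSum_sub, opSum_mul]
    exact opSum_compact (h₁.compact_selfAdjoint j hj) (h₂.compact_selfAdjoint j hj)
  compact_sq j hj := by
    rw [repSum_apply, opSum_mul, ← opSum_one, opSum_sub, opSum_mul]
    exact opSum_compact (h₁.compact_sq j hj) (h₂.compact_sq j hj)
  compact_commutator a := by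
    rw [repSum_apply, opSum_mul, opSum_mul, opSum_sub]
    exact opSum_compact (h₁.compact_commutator a) (h₂.compact_commutator a)

end DirectSum

namespace RelativeKCycle

variable {p : Parity} {J : TwoSidedIdeal A}

/-- The direct sum of relative `K`-cycles. -/
def sum (x y : RelativeKCycle.{u, v} p J) : RelativeKCycle.{u, v} p J :=
  haveI : SecondCountableTopology x.H := UniformSpace.secondCountable_of_separable x.H
  haveI : SecondCountableTopology y.H := UniformSpace.secondCountable_of_separable y.H
  (x.isCycle.sum y.isCycle).toCycle

/-- A relative `K`-cycle is degenerate if its three defining compact operators all vanish. -/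
def IsDegenerate (x : RelativeKCycle.{u, v} p J) : Prop :=
  (∀ j ∈ J, x.ρ j * (x.F - star x.F) = 0) ∧ (∀ j ∈ J, x.ρ j * (1 - x.F * x.F) = 0) ∧
    ∀ a : A, x.F * x.ρ a - x.ρ a * x.F = 0

/-- Unitary equivalence, through an even unitary. -/
def UnitarilyEquivalent (x y : RelativeKCycle.{u, v} p J) : Prop :=
  ∃ U : x.H ≃ₗᵢ[ℂ] y.H, (∀ ξ, U (x.γ ξ) = y.γ (U ξ)) ∧
    (∀ a ξ, U (x.ρ a ξ) = y.ρ a (U ξ)) ∧ ∀ ξ, U (x.F ξ) = y.F (U ξ)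

/-- `z` and `w` are the end points of an operator homotopy `(ρ, H, F_t)`, up to unitary
equivalence. -/
def OperatorHomotopic (z w : RelativeKCycle.{u, v} p J) : Prop :=
  ∃ (x : RelativeKCycle.{u, v} p J) (F : unitInterval → x.H →L[ℂ] x.H)
    (hF : ∀ t, IsRelativeKCycle p J x.γ x.ρ (F t)),
    Continuous F ∧ z.UnitarilyEquivalent (hF 0).toCycle ∧ (hF 1).toCycle.UnitarilyEquivalent w

/-- Two relative `K`-cycles are equivalent if, after adding degenerate ones, they become unitarily
equivalent to the end points of an operator homotopy. -/
def Equivalent (x y : RelativeKCycle.{u, v} p J) : Prop :=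
  ∃ x' y' : RelativeKCycle.{u, v} p J, x'.IsDegenerate ∧ y'.IsDegenerate ∧
    (x.sum x').OperatorHomotopic (y.sum y')

end RelativeKCycle

/-- The relative `K`-homology `K⁰(J ◁ A)` (for `p` even) and `K¹(J ◁ A)` (for `p` odd): the
equivalence classes of relative `K`-cycles. (`Quot` is the quotient by the equivalence relation
that `Equivalent` generates; `Equivalent` is one already.) -/
def RelativeKHomology (p : Parity) (J : TwoSidedIdeal A) : Type (max u (v + 1)) :=
  Quot (RelativeKCycle.Equivalent (A := A) (p := p) (J := J) :
    RelativeKCycle.{u, v} p J → RelativeKCycle.{u, v} p J → Prop)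

/-- The class of a relative `K`-cycle in relative `K`-homology. -/
def RelativeKCycle.toClass {p : Parity} {J : TwoSidedIdeal A} (x : RelativeKCycle.{u, v} p J) :
    RelativeKHomology.{u, v} p J :=
  Quot.mk _ x

end KHomology

end RelKHom

end

open RelKHom

/-! ### Compactness of adjoints, via the `C*`-identity. -/

section CompactOperators

variable {H : Type*} [NormedAddCommGroup H] [InnerProductSpace ℂ H]

/-! Put `r = (1 + D*D)^(-1/2)`, so that `D = F r⁻¹` and `F*F + r² = 1`. For `a ∈ 𝒜` (acting through
`ρ`) the operator `α = r⁻¹ a r` is bounded by the closed graph theorem, and `k = F α - a F` equals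
`[D, a] r`, which is compact by hypothesis. Since `[F, a] = F (a - α) + k`, everything rests on the
compactness of `a - α`.

This operator solves a Sylvester equation `r T + T r = Q` with `Q = k'* F r - F* k r` compact, where
`k'` belongs to `a*`. Formally `T = e^(-tr) T e^(-tr) + ∫₀ᵗ e^(-ur) Q e^(-ur) du`. The integral is
compact. The order condition makes `k r^(-ε)` bounded for `ε = min 1 (1/m)`, so the integrand is
`O(u^(-1-ε))`, and the remainder, which tends to `0` strongly because `r` is injective, is then
`O(t^(-ε))` in norm. The bound `O(u⁻¹)` available without `ε` would not suffice. This is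
`isCompactOperator_of_sylvester`, applied in `isCompactOperator_sub_conj`.

For the relative conditions let `s = (1 - F F*)^(1/2)`, which plays the role of `(1 + D D*)^(-1/2)`.
The inclusion `D ⊆ D*` is encoded by `g = s r + F F`, for which `s g = r` and `F* g = F`; hence `F*
j - j F = F* (j - g α) + k`. When `j = j₁ j₂` with both factors in `𝒥`, the operator `j - g α`
solves `s T + T r = Q` with `Q` compact and the same decay (`isCompactOperator_star_mul_sub`).
Together with the compactness of `[F, j]` and `j r` this settles the elements `j* j`; the
`C*`-identity and density extend the result to `J`. -/

theorem IsCompactOperator.mul_left {T : H →L[ℂ] H} (hT : IsCompactOperator T) (S : H →L[ℂ] H) :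
    IsCompactOperator (S * T : H →L[ℂ] H) := hT.clm_comp S

theorem IsCompactOperator.mul_right {T : H →L[ℂ] H} (hT : IsCompactOperator T) (S : H →L[ℂ] H) :
    IsCompactOperator (T * S : H →L[ℂ] H) := hT.comp_clm S

variable [CompleteSpace H]

/-- The `C*`-identity for compactness: `T` is compact as soon as `T* T` is. -/
theorem isCompactOperator_of_star_mul_self {T : H →L[ℂ] H}
    (h : IsCompactOperator (star T * T : H →L[ℂ] H)) : IsCompactOperator T := by
  have hb := (h.isCompact_closure_image_closedBall 1).totallyBounded.subset subset_closure
  -- `‖T v‖² = ⟪T*T v, v⟫` with `v = x - y` of norm at most `2`: points of the unit ball with close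
  -- images under `T*T` have close images under `T`.
  have key : ∀ x y : H, ‖x‖ ≤ 1 → ‖y‖ ≤ 1 →
      ‖T x - T y‖ ^ 2 ≤ 2 * ‖(star T * T) x - (star T * T) y‖ := by
    intro x y hx hy
    have h1 : ‖T x - T y‖ ^ 2 = RCLike.re ⟪(star T * T) x - (star T * T) y, x - y⟫_ℂ := by
      rw [← map_sub, ← map_sub, mul_apply_eq_comp, ContinuousLinearMap.star_eq_adjoint,
        ContinuousLinearMap.adjoint_inner_left, inner_self_eq_norm_sq (𝕜 := ℂ)]
    rw [h1]
    have h2 := re_inner_le_norm (𝕜 := ℂ) ((star T * T) x - (star T * T) y) (x - y)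
    have h3 : ‖x - y‖ ≤ 2 := (norm_sub_le x y).trans (by linarith)
    nlinarith [norm_nonneg ((star T * T) x - (star T * T) y)]
  have ht : TotallyBounded (T '' Metric.closedBall 0 1) := by
    rw [Metric.totallyBounded_iff] at hb ⊢
    intro e he
    -- Two points in one ball of radius `e²/8` are less than `e²/4` apart, so by `key` their
    -- `T`-images are at squared distance below `e²/2 < e²`.
    obtain ⟨t, htf, hts⟩ := hb (e ^ 2 / 8) (by positivity)
    classical
    -- The new centres are `T`-images of representatives; balls that meet no image get the
    -- irrelevant centre `0`.
    let pick : H → H := fun y =>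
      if h : ∃ x ∈ Metric.closedBall (0 : H) 1, (star T * T) x ∈ Metric.ball y (e ^ 2 / 8)
      then T h.choose else 0
    refine ⟨pick '' t, htf.image _, ?_⟩
    rintro _ ⟨x, hx, rfl⟩
    obtain ⟨y, hyt, hxy⟩ := Set.mem_iUnion₂.1 (hts ⟨x, hx, rfl⟩)
    have hex : ∃ x ∈ Metric.closedBall (0 : H) 1, (star T * T) x ∈ Metric.ball y (e ^ 2 / 8) :=
      ⟨x, hx, hxy⟩
    refine Set.mem_iUnion₂.2 ⟨pick y, ⟨y, hyt, rfl⟩, ?_⟩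
    have hp : pick y = T hex.choose := dif_pos hex
    obtain ⟨hz1, hz2⟩ := hex.choose_spec
    rw [Metric.mem_ball, hp, dist_eq_norm]
    have hd : ‖(star T * T) x - (star T * T) hex.choose‖ < e ^ 2 / 4 := by
      rw [← dist_eq_norm]
      have h1 := dist_triangle_right ((star T * T) x) ((star T * T) hex.choose) y
      have h2 := Metric.mem_ball.1 hxy
      have h3 := Metric.mem_ball.1 hz2
      have h2' : dist ((star T * T) x) y < e ^ 2 / 8 := h2
      linarith
    have := key x _ (mem_closedBall_zero_iff.1 hx) (mem_closedBall_zero_iff.1 hz1)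
    nlinarith [norm_nonneg (T x - T hex.choose)]
  refine (isCompactOperator_iff_isCompact_closure_image_closedBall (T : H →ₗ[ℂ] H) one_pos).2 ?_
  exact ht.closure.isCompact_of_isClosed isClosed_closure

theorem IsCompactOperator.star {T : H →L[ℂ] H} (hT : IsCompactOperator T) :
    IsCompactOperator (star T : H →L[ℂ] H) := by
  apply isCompactOperator_of_star_mul_self
  rw [star_star]
  exact hT.mul_right _

end CompactOperators

/-! ### Sylvester equations `s T + T r = Q` and the semigroups `e^(-tr)`. -/

section Semigroup

open Filter Topology

variable {H : Type*} [NormedAddCommGroup H] [InnerProductSpace ℂ H] [CompleteSpace H]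

/-- The semigroup `e^(-t r)`. -/
noncomputable def expSemigroup (r : H →L[ℂ] H) (t : ℝ) : H →L[ℂ] H := NormedSpace.exp (t • (-r))

theorem nonpos_of_mem_spectrum {y : H →L[ℂ] H} (hy : y ≤ 0) {x : ℝ} (hx : x ∈ spectrum ℝ y) :
    x ≤ 0 := by
  refine neg_nonneg.1 (spectrum_nonneg_of_nonneg (neg_nonneg.2 hy) ?_)
  rw [← spectrum.neg_eq]
  simpa using hx

theorem norm_exp_le_one_of_nonpos {y : H →L[ℂ] H} (hy : y ≤ 0) : ‖NormedSpace.exp y‖ ≤ 1 := by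
  have hsa : IsSelfAdjoint y := neg_neg y ▸ (IsSelfAdjoint.of_nonneg (neg_nonneg.2 hy)).neg
  rw [← CFC.real_exp_eq_normedSpace_exp hsa]
  refine norm_cfc_le zero_le_one fun x hx => ?_
  have := nonpos_of_mem_spectrum hy hx
  rw [Real.norm_of_nonneg (Real.exp_pos x).le]
  exact Real.exp_le_one_iff.2 this

/-- On the spectrum `|x| e^x ≤ 1`, because `-x ≤ e^(-x)`. Rescaling by `t` gives the decay `‖r
e^(-tr)‖ ≤ t⁻¹`. -/
theorem norm_mul_exp_le_one_of_nonpos {y : H →L[ℂ] H} (hy : y ≤ 0) :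
    ‖y * NormedSpace.exp y‖ ≤ 1 := by
  have hsa : IsSelfAdjoint y := neg_neg y ▸ (IsSelfAdjoint.of_nonneg (neg_nonneg.2 hy)).neg
  rw [← CFC.real_exp_eq_normedSpace_exp hsa]
  nth_rewrite 1 [← cfc_id ℝ y]
  rw [← cfc_mul _ _ y]
  refine norm_cfc_le zero_le_one fun x hx => ?_
  have hx0 := nonpos_of_mem_spectrum hy hx
  have h1 : -x ≤ Real.exp (-x) := by linarith [Real.add_one_le_exp (-x)]
  rw [norm_mul, Real.norm_of_nonneg (Real.exp_pos x).le, id, Real.norm_of_nonpos hx0]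
  calc -x * Real.exp x ≤ Real.exp (-x) * Real.exp x := by gcongr
    _ = 1 := by rw [← Real.exp_add]; simp

variable {r s : H →L[ℂ] H}

theorem smul_neg_nonpos (hr : 0 ≤ r) {t : ℝ} (ht : 0 ≤ t) : t • (-r) ≤ 0 := by
  rw [smul_neg, neg_nonpos]
  exact smul_nonneg ht hr

theorem norm_expSemigroup_le (hr : 0 ≤ r) {t : ℝ} (ht : 0 ≤ t) : ‖expSemigroup r t‖ ≤ 1 :=
  norm_exp_le_one_of_nonpos (smul_neg_nonpos hr ht)

theorem norm_mul_expSemigroup_le (hr : 0 ≤ r) {t : ℝ} (ht : 0 < t) :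
    ‖r * expSemigroup r t‖ ≤ t⁻¹ := by
  have h := norm_mul_exp_le_one_of_nonpos (smul_neg_nonpos hr ht.le)
  rw [smul_mul_assoc, norm_smul, neg_mul, norm_neg, Real.norm_of_nonneg ht.le] at h
  rw [← one_div, le_div_iff₀' ht]
  exact h

theorem expSemigroup_commute (r : H →L[ℂ] H) (t : ℝ) : Commute r (expSemigroup r t) :=
  (((Commute.refl r).neg_right).smul_right t).exp_right

theorem star_expSemigroup (hr : 0 ≤ r) (t : ℝ) : star (expSemigroup r t) = expSemigroup r t := by
  have : IsSelfAdjoint (t • (-r)) :=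
    IsSelfAdjoint.smul (IsSelfAdjoint.all t) (IsSelfAdjoint.of_nonneg hr).neg
  exact this.exp

theorem hasDerivAt_expSemigroup_conj (r s T : H →L[ℂ] H) (t : ℝ) :
    HasDerivAt (fun t => expSemigroup s t * T * expSemigroup r t)
      (-(expSemigroup s t * (s * T + T * r) * expSemigroup r t)) t := by
  have h1 : HasDerivAt (expSemigroup s) (expSemigroup s t * (-s)) t :=
    hasDerivAt_exp_smul_const (-s) t
  have h2 : HasDerivAt (expSemigroup r) ((-r) * expSemigroup r t) t :=
    hasDerivAt_exp_smul_const' (-r) t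
  convert! (h1.mul_const T).mul h2 using 1
  noncomm_ring

theorem denseRange_of_injective (hr : 0 ≤ r) (hi : Function.Injective r) : DenseRange r := by
  have hsa : IsSelfAdjoint r := IsSelfAdjoint.of_nonneg hr
  have h1 := ContinuousLinearMap.orthogonal_range r
  have h2 : ContinuousLinearMap.adjoint r = r := hsa
  rw [h2, LinearMap.ker_eq_bot.2 hi] at h1
  have := (Submodule.topologicalClosure_eq_top_iff (K := r.range)).2 h1
  rw [Submodule.dense_iff_topologicalClosure_eq_top.symm] at this
  exact this

/-- On the dense range of `r` the semigroup decays like `t⁻¹`, and contractivity carries the limit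
over to all vectors. -/
theorem tendsto_expSemigroup_apply (hr : 0 ≤ r) (hi : Function.Injective r) (x : H) :
    Tendsto (fun t => expSemigroup r t x) atTop (𝓝 0) := by
  rw [Metric.tendsto_atTop]
  intro e he
  obtain ⟨y, hy⟩ := (denseRange_of_injective hr hi).exists_dist_lt x (half_pos he)
  -- From this time on `t⁻¹ ‖y‖ < e/2`; the `+ 1` keeps `t` positive when `y = 0`.
  refine ⟨2 * (‖y‖ + 1) / e, fun t ht => ?_⟩
  have ht0 : 0 < t := lt_of_lt_of_le (by positivity) ht
  have h1 : expSemigroup r t x = expSemigroup r t (x - r y) + (r * expSemigroup r t) y := by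
    rw [(expSemigroup_commute r t).eq, mul_apply_eq_comp, ← map_add, sub_add_cancel]
  rw [dist_zero_right, h1]
  have h2 : ‖expSemigroup r t (x - r y)‖ ≤ ‖x - r y‖ := by
    simpa using (expSemigroup r t).le_of_opNorm_le (norm_expSemigroup_le hr ht0.le) (x - r y)
  have h3 := (r * expSemigroup r t).le_of_opNorm_le (norm_mul_expSemigroup_le hr ht0) y
  rw [dist_eq_norm] at hy
  have h4 : t⁻¹ * ‖y‖ < e / 2 := by
    rw [ge_iff_le, div_le_iff₀ he] at ht
    rw [inv_mul_lt_iff₀ ht0]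
    linarith
  have := norm_add_le (expSemigroup r t (x - r y)) ((r * expSemigroup r t) y)
  linarith

theorem tendsto_expSemigroup_conj_apply (hr : 0 ≤ r) (hs : 0 ≤ s) (hi : Function.Injective r)
    (T : H →L[ℂ] H) (x : H) :
    Tendsto (fun t => (expSemigroup s t * T * expSemigroup r t) x) atTop (𝓝 0) := by
  have h := ((tendsto_expSemigroup_apply hr hi x).norm).const_mul ‖T‖
  rw [norm_zero, mul_zero] at h
  refine squeeze_zero_norm' ?_ h
  filter_upwards [eventually_ge_atTop 0] with t ht
  have h1 := (expSemigroup s t).le_of_opNorm_le (norm_expSemigroup_le hs ht)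
    (T (expSemigroup r t x))
  have h2 := T.le_opNorm (expSemigroup r t x)
  rw [one_mul] at h1
  exact h1.trans h2

/-- Uniqueness for the Sylvester equation `s T + T r = Q`. -/
theorem eq_zero_of_sylvester (hr : 0 ≤ r) (hs : 0 ≤ s) (hi : Function.Injective r)
    {T : H →L[ℂ] H} (h : s * T + T * r = 0) : T = 0 := by
  have hd : ∀ t, HasDerivAt (fun t => expSemigroup s t * T * expSemigroup r t) 0 t := by
    intro t
    simpa [h] using hasDerivAt_expSemigroup_conj r s T t
  have hc : ∀ t, expSemigroup s t * T * expSemigroup r t = T := by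
    intro t
    have := is_const_of_deriv_eq_zero (fun t => (hd t).differentiableAt) (fun t => (hd t).deriv) t 0
    simpa [expSemigroup] using this
  ext x
  have := tendsto_expSemigroup_conj_apply hr hs hi T x
  simp only [hc] at this
  simpa using tendsto_nhds_unique tendsto_const_nhds this

/-- The difference is the integral of `e^(-us) Q e^(-ur)` over `[0, t]`. No integral is needed:
modulo the closed subspace of compact operators the conjugated path has derivative zero, hence is
constant. -/
theorem isCompactOperator_sub_expSemigroup_conj {T : H →L[ℂ] H}
    (hQ : IsCompactOperator (s * T + T * r : H →L[ℂ] H)) (t : ℝ) :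
    IsCompactOperator (T - expSemigroup s t * T * expSemigroup r t : H →L[ℂ] H) := by
  let K := compactOperator (RingHom.id ℂ) H H
  have : IsClosed (K : Set (H →L[ℂ] H)) := isClosed_setOfPred_isCompactOperator
  let q : (H →L[ℂ] H) →L[ℝ] ((H →L[ℂ] H) ⧸ K) :=
    (K.mkQL).restrictScalars ℝ
  have hd : ∀ t, HasDerivAt (fun t => q (expSemigroup s t * T * expSemigroup r t)) 0 t := by
    intro t
    have h1 := q.hasFDerivAt.comp_hasDerivAt t (hasDerivAt_expSemigroup_conj r s T t)
    have h2 : q (-(expSemigroup s t * (s * T + T * r) * expSemigroup r t)) = 0 := by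
      refine (Submodule.Quotient.mk_eq_zero K).2 (K.neg_mem ?_)
      exact (hQ.mul_left _).mul_right _
    rw [h2] at h1
    exact h1
  have := is_const_of_deriv_eq_zero (fun t => (hd t).differentiableAt) (fun t => (hd t).deriv) 0 t
  have h0 : expSemigroup s 0 * T * expSemigroup r 0 = T := by simp [expSemigroup]
  rw [h0] at this
  exact (Submodule.Quotient.eq K).1 this

/-- The norm is bounded by the tail `∫ₜ^∞ C u^(-1-ε) du`. -/
theorem norm_expSemigroup_conj_le (hr : 0 ≤ r) (hs : 0 ≤ s) (hi : Function.Injective r)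
    {T : H →L[ℂ] H} {C ε : ℝ} (hε : 0 < ε) (hC : 0 ≤ C)
    (hb : ∀ t, 0 < t →
      ‖expSemigroup s t * (s * T + T * r) * expSemigroup r t‖ ≤ C * t ^ (-1 - ε))
    {t : ℝ} (ht : 0 < t) :
    ‖expSemigroup s t * T * expSemigroup r t‖ ≤ C / ε * t ^ (-ε) := by
  set φ : ℝ → H →L[ℂ] H := fun t => expSemigroup s t * T * expSemigroup r t with hφ
  have hφd := hasDerivAt_expSemigroup_conj r s T
  -- The antiderivative of `C u^(-1-ε)` that vanishes at `t`; it serves as majorant in the mean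
  -- value inequality.
  have hB : ∀ u, 0 < u → HasDerivAt (fun u => C / ε * (t ^ (-ε) - u ^ (-ε)))
      (C * u ^ (-1 - ε)) u := by
    intro u hu
    have h1 := ((Real.hasDerivAt_rpow_const (p := -ε) (Or.inl hu.ne')).const_sub
      (t ^ (-ε))).const_mul (C / ε)
    convert! h1 using 1
    rw [show -1 - ε = -ε - 1 by ring]
    field_simp
  have hdiff : ∀ u, t ≤ u → ‖φ u - φ t‖ ≤ C / ε * t ^ (-ε) := by
    intro u hu
    have := image_norm_le_of_norm_deriv_right_le_deriv_boundary' (a := t) (b := u)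
      (f := fun v => φ v - φ t)
      (f' := fun v => -(expSemigroup s v * (s * T + T * r) * expSemigroup r v))
      (B := fun v => C / ε * (t ^ (-ε) - v ^ (-ε))) (B' := fun v => C * v ^ (-1 - ε))
      (fun v _ => ((hφd v).sub_const _).continuousAt.continuousWithinAt)
      (fun v _ => ((hφd v).sub_const _).hasDerivWithinAt)
      (by simp)
      (fun v hv => (hB v (ht.trans_le hv.1)).continuousAt.continuousWithinAt)
      (fun v hv => (hB v (ht.trans_le hv.1)).hasDerivWithinAt)
      (fun v hv => by rw [norm_neg]; exact hb v (ht.trans_le hv.1))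
      (Set.right_mem_Icc.2 hu)
    refine this.trans ?_
    have hu' : 0 ≤ u ^ (-ε) := Real.rpow_nonneg (ht.le.trans hu) _
    have : 0 ≤ C / ε := by positivity
    nlinarith
  -- The far end point `φ u` is so far known to vanish only strongly, so the limit `u → ∞` is taken
  -- on each vector separately.
  refine ContinuousLinearMap.opNorm_le_bound _ (by positivity) fun x => ?_
  have hlim : Tendsto (fun u => ‖φ u x‖ + C / ε * t ^ (-ε) * ‖x‖) atTop
      (𝓝 (0 + C / ε * t ^ (-ε) * ‖x‖)) := by
    have := (tendsto_expSemigroup_conj_apply hr hs hi T x).norm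
    rw [norm_zero] at this
    exact this.add_const _
  rw [zero_add] at hlim
  refine ge_of_tendsto hlim ?_
  filter_upwards [eventually_ge_atTop t] with u hu
  have h1 := (φ u - φ t).le_of_opNorm_le (hdiff u hu) x
  have h2 : ‖φ t x‖ ≤ ‖φ u x‖ + ‖(φ u - φ t) x‖ := by
    have := norm_sub_le (φ u x) ((φ u - φ t) x)
    rwa [sub_apply, sub_sub_cancel] at this
  exact h2.trans (by linarith)

/-- A solution `T` of the Sylvester equation `s T + T r = Q` with compact right hand side is compact
if `e^(-t s) Q e^(-t r)` decays fast enough. -/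
theorem isCompactOperator_of_sylvester (hr : 0 ≤ r) (hs : 0 ≤ s) (hi : Function.Injective r)
    {T : H →L[ℂ] H} {C ε : ℝ} (hε : 0 < ε) (hQ : IsCompactOperator (s * T + T * r : H →L[ℂ] H))
    (hb : ∀ t, 0 < t →
      ‖expSemigroup s t * (s * T + T * r) * expSemigroup r t‖ ≤ C * t ^ (-1 - ε)) :
    IsCompactOperator T := by
  have hC : 0 ≤ C := by
    have := (norm_nonneg _).trans (hb 1 one_pos)
    simpa using this
  refine isCompactOperator_of_tendsto (l := atTop)
    (F := fun t => T - expSemigroup s t * T * expSemigroup r t) ?_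
    (Eventually.of_forall (isCompactOperator_sub_expSemigroup_conj hQ))
  have h0 : Tendsto (fun t => expSemigroup s t * T * expSemigroup r t) atTop (𝓝 0) := by
    have h := (tendsto_rpow_neg_atTop hε).const_mul (C / ε)
    rw [mul_zero] at h
    refine squeeze_zero_norm' ?_ h
    filter_upwards [eventually_gt_atTop 0] with t ht
    exact norm_expSemigroup_conj_le hr hs hi hε hC hb ht
  simpa using h0.const_sub T

end Semigroup

/-! ### Compactness of the commutators, and functional calculus for powers. -/

section BoundedTransform

open Filter Topology

variable {H : Type*} [NormedAddCommGroup H] [InnerProductSpace ℂ H] [CompleteSpace H]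

/-- The family of interpolation inequalities satisfied by an operator `k` for which
`k r^(-ε)` is bounded. -/
def InterpolationBound (r : H →L[ℂ] H) (ε : ℝ) (k : H →L[ℂ] H) : Prop :=
  ∃ C, 0 ≤ C ∧ ∀ δ : ℝ, 0 < δ → ∀ x, ‖k x‖ ≤ C * δ ^ ε * (‖x‖ + δ⁻¹ * ‖r x‖)

variable {r s F : H →L[ℂ] H} {ε : ℝ}

/-- The choice `δ = t⁻¹` balances the two terms. The form with a general `S` is needed where `k`
does not stand directly next to a semigroup. -/
theorem InterpolationBound.exists_norm_mul_le {k : H →L[ℂ] H} (hk : InterpolationBound r ε k) :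
    ∃ C, 0 ≤ C ∧ ∀ (S : H →L[ℂ] H) (M t : ℝ), 0 < t → ‖S‖ ≤ M → ‖r * S‖ ≤ M * t⁻¹ →
      ‖k * S‖ ≤ C * M * t ^ (-ε) := by
  obtain ⟨C, hC, hk⟩ := hk
  refine ⟨2 * C, by positivity, fun S M t ht hS hrS => ?_⟩
  have hM : 0 ≤ M := (norm_nonneg S).trans hS
  refine ContinuousLinearMap.opNorm_le_bound _ (by positivity) fun x => ?_
  have h1 := hk t⁻¹ (inv_pos.2 ht) (S x)
  rw [inv_inv, Real.inv_rpow ht.le, ← Real.rpow_neg ht.le] at h1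
  have h2 := S.le_of_opNorm_le hS x
  have h3 := (r * S).le_of_opNorm_le hrS x
  have h4 : t * ‖r (S x)‖ ≤ M * ‖x‖ := by
    calc t * ‖r (S x)‖ ≤ t * (M * t⁻¹ * ‖x‖) := by gcongr; exact h3
      _ = M * ‖x‖ := by field_simp
  calc ‖k (S x)‖ ≤ C * t ^ (-ε) * (‖S x‖ + t * ‖r (S x)‖) := h1
    _ ≤ C * t ^ (-ε) * (M * ‖x‖ + M * ‖x‖) := by gcongr
    _ = 2 * C * M * t ^ (-ε) * ‖x‖ := by ring

theorem InterpolationBound.exists_norm_mul_expSemigroup_le {k : H →L[ℂ] H}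
    (hk : InterpolationBound r ε k) (hr : 0 ≤ r) :
    ∃ C, 0 ≤ C ∧ ∀ t, 0 < t → ‖k * expSemigroup r t‖ ≤ C * t ^ (-ε) := by
  obtain ⟨C, hC, h⟩ := hk.exists_norm_mul_le
  refine ⟨C, hC, fun t ht => ?_⟩
  simpa using h (expSemigroup r t) 1 t ht (norm_expSemigroup_le hr ht.le)
    (by simpa using norm_mul_expSemigroup_le hr ht)

/-- Half of the time is spent on `k`, gaining `t^(-ε)`, and half on `r`, gaining `t⁻¹`. -/
theorem InterpolationBound.exists_norm_mul_mul_expSemigroup_le {k : H →L[ℂ] H}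
    (hk : InterpolationBound r ε k) (hr : 0 ≤ r) :
    ∃ C, 0 ≤ C ∧ ∀ t, 0 < t → ‖k * r * expSemigroup r t‖ ≤ C * t ^ (-1 - ε) := by
  obtain ⟨C, hC, h⟩ := hk.exists_norm_mul_expSemigroup_le hr
  refine ⟨C * 2 ^ ε * 2, by positivity, fun t ht => ?_⟩
  have ht2 : 0 < t / 2 := by positivity
  have h2 : expSemigroup r t = expSemigroup r (t / 2) * expSemigroup r (t / 2) := by
    let _ : NormedAlgebra ℚ (H →L[ℂ] H) := NormedAlgebra.restrictScalars ℚ ℝ _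
    rw [expSemigroup, expSemigroup, ← NormedSpace.exp_add_of_commute (Commute.refl _), ← add_smul,
      add_halves]
  have h3 : k * r * expSemigroup r t =
      (k * expSemigroup r (t / 2)) * (r * expSemigroup r (t / 2)) := by
    rw [h2]
    have := (expSemigroup_commute r (t / 2)).eq
    calc k * r * (expSemigroup r (t / 2) * expSemigroup r (t / 2))
        = k * (r * expSemigroup r (t / 2)) * expSemigroup r (t / 2) := by simp only [mul_assoc]
      _ = k * (expSemigroup r (t / 2) * r) * expSemigroup r (t / 2) := by rw [this]
      _ = _ := by simp only [mul_assoc]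
  rw [h3]
  calc _ ≤ ‖k * expSemigroup r (t / 2)‖ * ‖r * expSemigroup r (t / 2)‖ := norm_mul_le _ _
    _ ≤ (C * (t / 2) ^ (-ε)) * (t / 2)⁻¹ :=
        mul_le_mul (h _ ht2) (norm_mul_expSemigroup_le hr ht2) (norm_nonneg _) (by positivity)
    _ = C * 2 ^ ε * 2 * t ^ (-1 - ε) := by
        rw [Real.div_rpow ht.le zero_le_two, Real.rpow_neg zero_le_two, Real.rpow_sub ht,
          Real.rpow_neg ht.le, Real.rpow_neg ht.le, Real.rpow_one]
        field_simp

theorem rpow_neg_mul_inv {t : ℝ} (ht : 0 < t) (ε : ℝ) : t ^ (-ε) * t⁻¹ = t ^ (-1 - ε) := by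
  rw [← Real.rpow_neg_one t, ← Real.rpow_add ht]
  ring_nf

theorem norm_star_comm {S T : H →L[ℂ] H} : ‖star S * star T‖ = ‖T * S‖ := by
  rw [← star_mul, norm_star]

/-- If `a` preserves the range of `r` and `α = r⁻¹ a r`, then `a - α` is compact provided that the
commutators `k = F α - a F` of `a` and `a*` with `D = F r⁻¹` are compact with an interpolation
bound. -/
theorem isCompactOperator_sub_conj (hr : 0 ≤ r) (hi : Function.Injective r) (hε : 0 < ε)
    (hF : star F * F + r * r = 1) {a α α' : H →L[ℂ] H} (hα : a * r = r * α)
    (hα' : star a * r = r * α')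
    (hk : IsCompactOperator (F * α - a * F : H →L[ℂ] H))
    (hk' : IsCompactOperator (F * α' - star a * F : H →L[ℂ] H))
    (hb : InterpolationBound r ε (F * α - a * F))
    (hb' : InterpolationBound r ε (F * α' - star a * F)) :
    IsCompactOperator (a - α : H →L[ℂ] H) := by
  have hrs : star r = r := (IsSelfAdjoint.of_nonneg hr).star_eq
  have hα'' : r * a = star α' * r := by
    simpa [hrs] using congrArg star hα'
  set k := F * α - a * F with hk_def
  set k' := F * α' - star a * F with hk'_def
  have hks : star k' = star α' * star F - star F * a := by simp [hk'_def]
  -- The left side is `r a - α r` because `a r = r α`. On the right the terms `F* a F r` cancel;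
  -- after replacing `F*F` by `1 - r²`, the two terms of higher order in `r` both equal `r a r²` and
  -- cancel as well.
  have hQ : r * (a - α) + (a - α) * r = star k' * (F * r) - star F * (k * r) := by
    rw [hks, hk_def]
    linear_combination (norm := noncomm_ring)
      hα - star α' * hF * r + hF * α * r + hα'' - hα'' * r * r + r * hα * r
  obtain ⟨C₁, hC₁, h₁⟩ := hb.exists_norm_mul_mul_expSemigroup_le hr
  obtain ⟨C₂, hC₂, h₂⟩ := hb'.exists_norm_mul_expSemigroup_le hr
  refine isCompactOperator_of_sylvester (C := C₂ * ‖F‖ + ‖F‖ * C₁) hr hr hi hε ?_ ?_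
  · rw [hQ]
    exact (hk'.star.mul_right _).sub ((hk.mul_right r).mul_left _)
  intro t ht
  rw [hQ]
  -- In the first term both semigroups contribute, to `k'*` and to `r`; in the second the right one
  -- provides all the decay and the left one is merely a contraction.
  have e : expSemigroup r t * (star k' * (F * r) - star F * (k * r)) * expSemigroup r t =
      (expSemigroup r t * star k') * (F * (r * expSemigroup r t)) -
        expSemigroup r t * (star F * (k * r * expSemigroup r t)) := by noncomm_ring
  have n1 : ‖expSemigroup r t * star k'‖ ≤ C₂ * t ^ (-ε) := by
    rw [← star_expSemigroup hr t, norm_star_comm]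
    exact h₂ t ht
  have n2 := norm_mul_expSemigroup_le hr ht
  have n3 := h₁ t ht
  have n4 := norm_expSemigroup_le hr ht.le
  rw [e]
  calc _ ≤ _ := norm_sub_le _ _
    _ ≤ ‖expSemigroup r t * star k'‖ * (‖F‖ * ‖r * expSemigroup r t‖) +
        ‖expSemigroup r t‖ * (‖star F‖ * ‖k * r * expSemigroup r t‖) := by
      refine add_le_add ((norm_mul_le _ _).trans ?_) ((norm_mul_le _ _).trans ?_) <;>
      · gcongr
        exact norm_mul_le _ _
    _ ≤ (C₂ * t ^ (-ε)) * (‖F‖ * t⁻¹) + 1 * (‖F‖ * (C₁ * t ^ (-1 - ε))) := by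
      rw [norm_star]
      gcongr
    _ = _ := by rw [← rpow_neg_mul_inv ht]; ring

theorem isCompactOperator_commutator (hr : 0 ≤ r) (hi : Function.Injective r) (hε : 0 < ε)
    (hF : star F * F + r * r = 1) {a α α' : H →L[ℂ] H} (hα : a * r = r * α)
    (hα' : star a * r = r * α')
    (hk : IsCompactOperator (F * α - a * F : H →L[ℂ] H))
    (hk' : IsCompactOperator (F * α' - star a * F : H →L[ℂ] H))
    (hb : InterpolationBound r ε (F * α - a * F))
    (hb' : InterpolationBound r ε (F * α' - star a * F)) :
    IsCompactOperator (F * a - a * F : H →L[ℂ] H) := by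
  have h := isCompactOperator_sub_conj hr hi hε hF hα hα' hk hk' hb hb'
  have e : F * a - a * F = F * (a - α) + (F * α - a * F) := by noncomm_ring
  rw [e]
  exact (h.mul_left F).add hk

/-- For `j = j₁ j₂` mapping `dom D*` into `dom D`, the difference `F* j - j F` is compact. Here
`D = F r⁻¹` and `D* = F* s⁻¹`. -/
theorem isCompactOperator_star_mul_sub (hr : 0 ≤ r) (hs : 0 ≤ s) (hi : Function.Injective r)
    (hε : 0 < ε) (hF : star F * F + r * r = 1) (hF' : F * star F + s * s = 1)
    (hrs : F * r = s * F) (hsymm : r * F = star F * r)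
    {j₁ j₂ α₁ α α₂' β₁' β₂ : H →L[ℂ] H} (hα₁ : j₁ * r = r * α₁) (hα : j₁ * j₂ * r = r * α)
    (hα₂' : star j₂ * r = r * α₂') (hβ₁' : star j₁ * s = r * β₁') (hβ₂ : j₂ * s = r * β₂)
    (hk₁ : IsCompactOperator (F * α₁ - j₁ * F : H →L[ℂ] H))
    (hk₂ : IsCompactOperator (F * α₂' - star j₂ * F : H →L[ℂ] H))
    (hk : IsCompactOperator (F * α - j₁ * j₂ * F : H →L[ℂ] H))
    (hb₁ : InterpolationBound r ε (F * α₁ - j₁ * F))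
    (hb₂ : InterpolationBound r ε (F * α₂' - star j₂ * F))
    (hb : InterpolationBound r ε (F * α - j₁ * j₂ * F)) :
    IsCompactOperator (star F * (j₁ * j₂) - j₁ * j₂ * F : H →L[ℂ] H) := by
  have hrr : star r = r := (IsSelfAdjoint.of_nonneg hr).star_eq
  have hss : star s = s := (IsSelfAdjoint.of_nonneg hs).star_eq
  have hα₂'' : r * j₂ = star α₂' * r := by simpa [hrr] using congrArg star hα₂'
  have hβ₁'' : s * j₁ = star β₁' * r := by simpa [hrr, hss] using congrArg star hβ₁'
  have hrs' : r * star F = star F * s := by simpa [hrr, hss] using congrArg star hrs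
  set k₁ := F * α₁ - j₁ * F with hk₁_def
  set k₂ := F * α₂' - star j₂ * F with hk₂_def
  set k := F * α - j₁ * j₂ * F with hk_def
  have hk₂s : star k₂ = star α₂' * star F - star F * j₂ := by simp [hk₂_def]
  -- Formally `(r x, F x)` parametrizes the graph of `D` and `(s y, F* y)` that of `D*`; `y = (s r +
  -- F F) x` expresses the inclusion of the former in the latter.
  have hsg : s * (s * r + F * F) = r := by
    linear_combination (norm := noncomm_ring) hF' * r - hrs * F + F * hsymm
  have hFg : star F * (s * r + F * F) = F := by
    linear_combination (norm := noncomm_ring) -hrs' * r + hF * F - r * hsymm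
  -- As `s g α = r α = j r` for `g = s r + F F` and `j = j₁ j₂`, the left side is `s j - g α r`.
  -- Each factor of `j` uses once that it passes from `dom D*` to `dom D`: `β₂ = r⁻¹ j₂ s`, and
  -- `star β₁'` extends `s j₁ r⁻¹`.
  have hQ : s * (j₁ * j₂ - (s * r + F * F) * α) + (j₁ * j₂ - (s * r + F * F) * α) * r =
      -(s * (k₁ * (β₂ * F))) + (star β₁' * star k₂) * (F * r) - F * (k * r) := by
    have e : -(s * (k₁ * (β₂ * F))) + (star β₁' * star k₂) * (F * r) - F * (k * r) =
        s * (j₁ * j₂) - (s * r + F * F) * α * r := by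
      rw [hk₂s, hk₁_def, hk_def]
      linear_combination (norm := noncomm_ring)
        hrs * α₁ * β₂ * F + F * hα₁ * β₂ * F + F * j₁ * hβ₂ * F + F * j₁ * j₂ * hrs
          + star β₁' * star α₂' * hF * r - star β₁' * hα₂'' - hβ₁'' * j₂
          + star β₁' * hα₂'' * r * r + hβ₁'' * j₂ * r * r - s * hα * r
          - star β₁' * star F * j₂ * hrs - star β₁' * star F * hβ₂ * F
          + star β₁' * hsymm * β₂ * F + hβ₁'' * F * β₂ * F
    rw [e]
    linear_combination (norm := noncomm_ring) -hsg * α + hα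
  have hT : IsCompactOperator (j₁ * j₂ - (s * r + F * F) * α : H →L[ℂ] H) := by
    obtain ⟨C₁, hC₁, h₁⟩ := hb₁.exists_norm_mul_le
    obtain ⟨C₂, hC₂, h₂⟩ := hb₂.exists_norm_mul_le
    obtain ⟨C₃, hC₃, h₃⟩ := hb.exists_norm_mul_mul_expSemigroup_le hr
    refine isCompactOperator_of_sylvester
      (C := C₁ * (‖β₂ * F‖ + ‖j₂ * F‖) + C₂ * (‖β₁'‖ + ‖star j₁‖) * ‖F‖ + ‖F‖ * C₃)
      hr hs hi hε ?_ ?_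
    · rw [hQ]
      exact ((((hk₁.mul_right _).mul_left s).neg).add
        ((hk₂.star.mul_left _).mul_right _)).sub ((hk.mul_right r).mul_left F)
    intro t ht
    rw [hQ]
    have e : expSemigroup s t * (-(s * (k₁ * (β₂ * F))) + (star β₁' * star k₂) * (F * r) -
        F * (k * r)) * expSemigroup r t =
        -((s * expSemigroup s t) * (k₁ * (β₂ * F * expSemigroup r t))) +
        (expSemigroup s t * (star β₁' * star k₂)) * (F * (r * expSemigroup r t)) -
          expSemigroup s t * (F * (k * r * expSemigroup r t)) := by
      rw [(expSemigroup_commute s t).eq]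
      noncomm_ring
    have n1 : ‖k₁ * (β₂ * F * expSemigroup r t)‖ ≤ C₁ * (‖β₂ * F‖ + ‖j₂ * F‖) * t ^ (-ε) := by
      refine h₁ _ _ t ht ?_ ?_
      · calc _ ≤ ‖β₂ * F‖ * ‖expSemigroup r t‖ := norm_mul_le _ _
          _ ≤ ‖β₂ * F‖ * 1 := by gcongr; exact norm_expSemigroup_le hr ht.le
          _ ≤ _ := by linarith [norm_nonneg (j₂ * F)]
      · have : r * (β₂ * F * expSemigroup r t) = j₂ * F * (r * expSemigroup r t) := by
          linear_combination (norm := noncomm_ring)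
            -hβ₂ * F * expSemigroup r t - j₂ * hrs * expSemigroup r t
        rw [this]
        calc _ ≤ ‖j₂ * F‖ * ‖r * expSemigroup r t‖ := norm_mul_le _ _
          _ ≤ (‖β₂ * F‖ + ‖j₂ * F‖) * t⁻¹ := by
            gcongr
            · linarith [norm_nonneg (β₂ * F)]
            · exact norm_mul_expSemigroup_le hr ht
    have n2 : ‖expSemigroup s t * (star β₁' * star k₂)‖ ≤
        C₂ * (‖β₁'‖ + ‖star j₁‖) * t ^ (-ε) := by
      rw [← star_expSemigroup hs t, ← star_mul, norm_star_comm, mul_assoc]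
      refine h₂ _ _ t ht ?_ ?_
      · calc _ ≤ ‖β₁'‖ * ‖expSemigroup s t‖ := norm_mul_le _ _
          _ ≤ ‖β₁'‖ * 1 := by gcongr; exact norm_expSemigroup_le hs ht.le
          _ ≤ _ := by linarith [norm_nonneg (star j₁)]
      · rw [← mul_assoc, ← hβ₁', mul_assoc]
        calc _ ≤ ‖star j₁‖ * ‖s * expSemigroup s t‖ := norm_mul_le _ _
          _ ≤ (‖β₁'‖ + ‖star j₁‖) * t⁻¹ := by
            gcongr
            · linarith [norm_nonneg β₁']
            · exact norm_mul_expSemigroup_le hs ht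
    have n3 := h₃ t ht
    have n4 := norm_mul_expSemigroup_le hr ht
    have n5 := norm_mul_expSemigroup_le hs ht
    have n6 := norm_expSemigroup_le hs ht.le
    rw [e]
    calc _ ≤ ‖-((s * expSemigroup s t) * (k₁ * (β₂ * F * expSemigroup r t)))‖ +
        ‖(expSemigroup s t * (star β₁' * star k₂)) * (F * (r * expSemigroup r t))‖ +
        ‖expSemigroup s t * (F * (k * r * expSemigroup r t))‖ :=
          (norm_sub_le _ _).trans (add_le_add_left (norm_add_le _ _) _)
      _ ≤ ‖s * expSemigroup s t‖ * ‖k₁ * (β₂ * F * expSemigroup r t)‖ +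
          ‖expSemigroup s t * (star β₁' * star k₂)‖ * (‖F‖ * ‖r * expSemigroup r t‖) +
          ‖expSemigroup s t‖ * (‖F‖ * ‖k * r * expSemigroup r t‖) := by
        rw [norm_neg]
        refine add_le_add (add_le_add (norm_mul_le _ _) ((norm_mul_le _ _).trans ?_))
          ((norm_mul_le _ _).trans ?_) <;>
        · gcongr
          exact norm_mul_le _ _
      _ ≤ t⁻¹ * (C₁ * (‖β₂ * F‖ + ‖j₂ * F‖) * t ^ (-ε)) +
          (C₂ * (‖β₁'‖ + ‖star j₁‖) * t ^ (-ε)) * (‖F‖ * t⁻¹) +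
          1 * (‖F‖ * (C₃ * t ^ (-1 - ε))) := by gcongr
      _ = _ := by rw [← rpow_neg_mul_inv ht]; ring
  have e : star F * (j₁ * j₂) - j₁ * j₂ * F =
      star F * (j₁ * j₂ - (s * r + F * F) * α) + k := by
    rw [hk_def]
    linear_combination (norm := noncomm_ring) hFg * α
  rw [e]
  exact (hT.mul_left _).add hk

/-- Positive square roots of `1 - F* F` and `1 - F F*` are intertwined by `F`. -/
theorem intertwine_sqrt (hr : 0 ≤ r) (hs : 0 ≤ s) (hi : Function.Injective r)
    (hF : star F * F + r * r = 1) (hF' : F * star F + s * s = 1) : F * r = s * F := by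
  rw [← sub_eq_zero]
  refine eq_zero_of_sylvester hr hs hi ?_
  -- For `T = F r - s F` one has `s T + T r = F r² - s² F`, and both terms equal `F - F F* F`.
  linear_combination (norm := noncomm_ring) F * hF - hF' * F

/-- `F*F ≤ 1` and `F F* ≤ 1` both say `‖F‖ ≤ 1`. -/
theorem exists_sqrt_one_sub_mul_star (hF : star F * F + r * r = 1) (hr : 0 ≤ r) :
    ∃ s : H →L[ℂ] H, 0 ≤ s ∧ F * star F + s * s = 1 := by
  have hrr : star r = r := (IsSelfAdjoint.of_nonneg hr).star_eq
  have h1 : star F * F ≤ 1 := by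
    rw [← hF]
    have : 0 ≤ r * r := by simpa [hrr] using star_mul_self_nonneg r
    exact le_add_of_nonneg_right this
  have h2 : F * star F ≤ 1 := by
    have h3 : ‖star F * F‖ ≤ 1 :=
      (CStarAlgebra.norm_le_one_iff_of_nonneg _ (star_mul_self_nonneg F)).2 h1
    rw [← CStarAlgebra.norm_le_one_iff_of_nonneg _ (mul_star_self_nonneg F),
      CStarRing.norm_self_mul_star]
    rwa [CStarRing.norm_star_mul_self] at h3
  refine ⟨CFC.sqrt (1 - F * star F), CFC.sqrt_nonneg _, ?_⟩
  rw [CFC.sqrt_mul_sqrt_self _ (sub_nonneg.2 h2)]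
  abel

/-- Division of bounded operators by closed graph. -/
theorem exists_factor_of_range_le {r S : H →L[ℂ] H} (hi : Function.Injective r)
    (h : ∀ x, ∃ y, r y = S x) : ∃ α : H →L[ℂ] H, S = r * α := by
  choose f hf using h
  let g : H →ₗ[ℂ] H :=
    { toFun := f
      map_add' := fun x y => hi (by rw [map_add, hf, hf, hf, map_add])
      map_smul' := fun c x => hi (by rw [RingHom.id_apply, map_smul, hf, hf, map_smul]) }
  refine ⟨ContinuousLinearMap.ofSeqClosedGraph (g := g) fun u x y hu hg => hi ?_, ?_⟩
  · have h1 : Tendsto (fun n => r (f (u n))) atTop (𝓝 (r y)) := (r.continuous.tendsto y).comp hg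
    simp only [hf] at h1
    have h2 := (S.continuous.tendsto x).comp hu
    exact (tendsto_nhds_unique h1 h2).trans (hf x).symm
  · ext x
    exact (hf x).symm

theorem rpow_mul_rpow {R : H →L[ℂ] H} (hR : 0 ≤ R) {p q : ℝ} (hp : 0 ≤ p) (hq : 0 ≤ q) :
    R ^ p * R ^ q = R ^ (p + q) := by
  rcases hp.eq_or_lt with rfl | hp
  · rw [CFC.rpow_zero R hR, zero_add, one_mul]
  rcases hq.eq_or_lt with rfl | hq
  · rw [CFC.rpow_zero R hR, add_zero, mul_one]
  lift p to NNReal using hp.le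
  lift q to NNReal using hq.le
  have hp' : 0 < p := by exact_mod_cast hp
  have hq' : 0 < q := by exact_mod_cast hq
  rw [← NNReal.coe_add, ← CFC.nnrpow_eq_rpow hp', ← CFC.nnrpow_eq_rpow hq',
    ← CFC.nnrpow_eq_rpow (add_pos hp' hq'), CFC.nnrpow_add hp' hq']

/-- `R^p` is a right factor of the injective operator `R^n` for a natural number `n ≥ p`. -/
theorem injective_rpow {R : H →L[ℂ] H} (hR : 0 ≤ R) (hi : Function.Injective R) {p : ℝ}
    (hp : 0 ≤ p) : Function.Injective (R ^ p : H →L[ℂ] H) := by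
  obtain ⟨n, hn⟩ := exists_nat_ge p
  have h1 : (R ^ ((n : ℝ) - p) * R ^ p : H →L[ℂ] H) = R ^ n := by
    rw [rpow_mul_rpow hR (sub_nonneg.2 hn) hp, sub_add_cancel, CFC.rpow_natCast R n hR]
  have h2 : Function.Injective (R ^ n : H →L[ℂ] H) := by
    have h3 : ⇑(R ^ n : H →L[ℂ] H) = R^[n] := hom_coe_pow _ rfl (fun _ _ => rfl) _ _
    rw [h3]
    exact hi.iterate n
  rw [← h1] at h2
  exact Function.Injective.of_comp h2

/-- After squaring, this follows from the scalar inequality `y^ε ≤ δ^(2ε) (1 + δ⁻² y)` on the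
spectrum, that is, from `z^ε ≤ 1 + z` at `z = δ⁻² y`. It turns boundedness of `k r^(-ε)` into
`InterpolationBound`. -/
theorem norm_rpow_apply_le {R : H →L[ℂ] H} (hR : 0 ≤ R) (hε : 0 < ε) (hε1 : ε ≤ 1) {δ : ℝ}
    (hδ : 0 < δ) (x : H) :
    ‖(R ^ (ε / 2) : H →L[ℂ] H) x‖ ≤ δ ^ ε * (‖x‖ + δ⁻¹ * ‖(R ^ (1 / 2 : ℝ) : H →L[ℂ] H) x‖) := by
  have hsq : ∀ p : ℝ, 0 ≤ p → ‖(R ^ (p / 2) : H →L[ℂ] H) x‖ ^ 2 =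
      RCLike.re ⟪(R ^ p : H →L[ℂ] H) x, x⟫_ℂ := by
    intro p hp
    have hsa : IsSelfAdjoint (R ^ (p / 2) : H →L[ℂ] H) := IsSelfAdjoint.of_nonneg CFC.rpow_nonneg
    rw [← add_halves p, ← rpow_mul_rpow hR (by positivity) (by positivity), add_halves,
      mul_apply_eq_comp, ← ContinuousLinearMap.adjoint_inner_right,
      ← ContinuousLinearMap.star_eq_adjoint, hsa.star_eq, inner_self_eq_norm_sq (𝕜 := ℂ)]
  have hle : (R ^ ε : H →L[ℂ] H) ≤ (δ ^ (2 * ε)) • (1 + (δ⁻¹ ^ 2) • R) := by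
    have hsa : IsSelfAdjoint R := IsSelfAdjoint.of_nonneg hR
    have e : (δ ^ (2 * ε)) • (1 + (δ⁻¹ ^ 2) • R) =
        cfc (fun x : ℝ => δ ^ (2 * ε) * (1 + δ⁻¹ ^ 2 * x)) R := by
      rw [cfc_const_mul .., cfc_const_add .., cfc_const_mul_id ..]
      simp
    rw [e, CFC.rpow_eq_cfc_real hR]
    refine cfc_mono (fun y hy => ?_) (Real.continuous_rpow_const hε.le).continuousOn
    have hy0 : 0 ≤ y := spectrum_nonneg_of_nonneg hR hy
    have hz : 0 ≤ δ⁻¹ ^ 2 * y := by positivity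
    have h1 : (δ⁻¹ ^ 2 * y) ^ ε ≤ 1 + δ⁻¹ ^ 2 * y := by
      rcases le_total (δ⁻¹ ^ 2 * y) 1 with h | h
      · exact (Real.rpow_le_one hz h hε.le).trans (by linarith)
      · calc _ ≤ (δ⁻¹ ^ 2 * y) ^ (1 : ℝ) := Real.rpow_le_rpow_of_exponent_le h hε1
          _ ≤ _ := by rw [Real.rpow_one]; linarith
    calc y ^ ε = (δ ^ 2 * (δ⁻¹ ^ 2 * y)) ^ ε := by congr 1; field_simp
      _ = δ ^ (2 * ε) * (δ⁻¹ ^ 2 * y) ^ ε := by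
        rw [Real.mul_rpow (by positivity) hz, Real.rpow_mul hδ.le, Real.rpow_two]
      _ ≤ _ := by gcongr
  have h := ContinuousLinearMap.IsPositive.re_inner_nonneg_left
    ((ContinuousLinearMap.nonneg_iff_isPositive _).1 (sub_nonneg.2 hle)) x
  have h1 := hsq 1 zero_le_one
  have h2 := hsq ε hε.le
  rw [CFC.rpow_one R hR] at h1
  have e : ((δ ^ (2 * ε)) • (1 + (δ⁻¹ ^ 2) • R) - R ^ ε : H →L[ℂ] H) x =
      ((δ ^ (2 * ε) : ℝ) : ℂ) • (x + ((δ⁻¹ ^ 2 : ℝ) : ℂ) • R x) - (R ^ ε : H →L[ℂ] H) x := by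
    simp only [Complex.coe_smul]
    rfl
  rw [e, inner_sub_left, inner_smul_left, inner_add_left, inner_smul_left, Complex.conj_ofReal,
    Complex.conj_ofReal, map_sub, RCLike.re_to_complex, Complex.re_ofReal_mul, Complex.add_re,
    Complex.re_ofReal_mul] at h
  change 0 ≤ δ ^ (2 * ε) * (RCLike.re ⟪x, x⟫_ℂ + δ⁻¹ ^ 2 * RCLike.re ⟪R x, x⟫_ℂ) -
    RCLike.re ⟪(R ^ ε : H →L[ℂ] H) x, x⟫_ℂ at h
  rw [← h1, ← h2, inner_self_eq_norm_sq (𝕜 := ℂ)] at h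
  refine le_of_sq_le_sq ?_ (by positivity)
  have e2 : δ ^ (2 * ε) = (δ ^ ε) ^ 2 := by
    rw [mul_comm, Real.rpow_mul hδ.le, Real.rpow_two]
  rw [e2] at h
  rw [mul_pow, add_sq, mul_pow]
  have : 0 ≤ 2 * ‖x‖ * (δ⁻¹ * ‖(R ^ (1 / 2 : ℝ) : H →L[ℂ] H) x‖) := by positivity
  nlinarith [mul_nonneg (sq_nonneg (δ ^ ε)) this]

end BoundedTransform

/-! ### The bounded transform of a closed operator. -/

section UnboundedOperators

variable {H : Type*} [NormedAddCommGroup H] [InnerProductSpace ℂ H]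

theorem apply_of_opMul_le {S P : H →ₗ.[ℂ] H} {K : H →L[ℂ] H} (h : opMul S P ≤ ofBounded K)
    (z : P.domain) (hz : P z ∈ S.domain) : K z = S ⟨P z, hz⟩ :=
  (h.2 (x := (⟨z, z.2, hz⟩ : (opMul S P).domain)) (y := ⟨z, trivial⟩) rfl).symm

theorem opCommutator_apply (D : H →ₗ.[ℂ] H) (a : H →L[ℂ] H) {x : H} (hx : x ∈ D.domain)
    (hax : a x ∈ D.domain) :
    ∃ h : x ∈ (opCommutator D a).domain, opCommutator D a ⟨x, h⟩ = D ⟨a x, hax⟩ - a (D ⟨x, hx⟩) :=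
  ⟨⟨⟨trivial, hax⟩, ⟨hx, trivial⟩⟩, rfl⟩

theorem ofBounded_injective {S T : H →L[ℂ] H} (h : ofBounded S = ofBounded T) : S = T := by
  ext x
  exact h.le.2 (x := ⟨x, trivial⟩) (y := ⟨x, trivial⟩) rfl

variable [CompleteSpace H] {D : H →ₗ.[ℂ] H}

theorem injective_oneAddSqInv (hc : D.IsClosed) (hd : Dense (D.domain : Set H)) :
    Function.Injective (oneAddSqInv D) := by
  rw [injective_iff_map_eq_zero]
  intro y hy
  exact LinearPMap.graph_fst_eq_zero_snd _ ((oneAddSq_graph hc hd 0 y).2 hy) rfl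

/-- The bounded operator `(1 + D* D)^(-1/2)`. -/
noncomputable def oneAddSqInvSqrt (D : H →ₗ.[ℂ] H) : H →L[ℂ] H := oneAddSqInv D ^ (1 / 2 : ℝ)

theorem oneAddSqInvSqrt_nonneg (D : H →ₗ.[ℂ] H) : 0 ≤ oneAddSqInvSqrt D := CFC.rpow_nonneg

theorem oneAddSqInvSqrt_mul_self (D : H →ₗ.[ℂ] H) :
    oneAddSqInvSqrt D * oneAddSqInvSqrt D = oneAddSqInv D := by
  have hR := oneAddSqInv_nonneg D
  rw [oneAddSqInvSqrt, rpow_mul_rpow hR (by norm_num) (by norm_num), add_halves,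
    CFC.rpow_one _ hR]

theorem star_oneAddSqInvSqrt (D : H →ₗ.[ℂ] H) : star (oneAddSqInvSqrt D) = oneAddSqInvSqrt D :=
  (IsSelfAdjoint.of_nonneg (oneAddSqInvSqrt_nonneg D)).star_eq

theorem injective_oneAddSqInvSqrt (hc : D.IsClosed) (hd : Dense (D.domain : Set H)) :
    Function.Injective (oneAddSqInvSqrt D) :=
  injective_rpow (oneAddSqInv_nonneg D) (injective_oneAddSqInv hc hd) (by norm_num)

theorem oneAddSqPow_of_nonpos (D : H →ₗ.[ℂ] H) {s : ℝ} (hs : s ≤ 0) :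
    oneAddSqPow D s = ofBounded (oneAddSqInv D ^ (-s)) := if_pos hs

theorem oneAddSqPow_neg_half (D : H →ₗ.[ℂ] H) :
    oneAddSqPow D (-(1 / 2)) = ofBounded (oneAddSqInvSqrt D) := by
  rw [oneAddSqPow_of_nonpos D (by norm_num), neg_neg, oneAddSqInvSqrt]

theorem oneAddSqPow_apply_of_pos (hc : D.IsClosed) (hd : Dense (D.domain : Set H)) {s : ℝ}
    (hs : 0 < s) (y : H) : ∃ h : (oneAddSqInv D ^ s : H →L[ℂ] H) y ∈ (oneAddSqPow D s).domain,
      oneAddSqPow D s ⟨_, h⟩ = y := by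
  have hi := injective_rpow (oneAddSqInv_nonneg D) (injective_oneAddSqInv hc hd) hs.le
  have hker : LinearMap.ker (ofBounded (oneAddSqInv D ^ s)).toFun = ⊥ := by
    rw [LinearMap.ker_eq_bot']
    rintro ⟨y, hy⟩ h0
    exact Subtype.ext ((injective_iff_map_eq_zero _).1 hi y h0)
  rw [oneAddSqPow, if_neg hs.not_ge]
  refine ⟨by rw [LinearPMap.inverse_domain]; exact ⟨⟨y, trivial⟩, rfl⟩, ?_⟩
  exact LinearPMap.inverse_apply_eq hker (x := ⟨y, trivial⟩) rfl

/-- The bounded transform as a bounded operator: `D (1 + D* D)^(-1/2)` is everywhere defined, and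
`(1 + D* D)^(-1/2)` has range `dom D`. -/
theorem exists_boundedTransform (hc : D.IsClosed) (hd : Dense (D.domain : Set H)) :
    ∃ F : H →L[ℂ] H, (∀ x, ∃ h : oneAddSqInvSqrt D x ∈ D.domain, D ⟨_, h⟩ = F x) ∧
      (∀ y ∈ D.domain, ∃ x, oneAddSqInvSqrt D x = y) ∧
      star F * F + oneAddSqInvSqrt D * oneAddSqInvSqrt D = 1 := by
  set r := oneAddSqInvSqrt D
  have hr : 0 ≤ r := oneAddSqInvSqrt_nonneg D
  have hi : Function.Injective r := injective_oneAddSqInvSqrt hc hd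
  have hrr : ContinuousLinearMap.adjoint r = r := star_oneAddSqInvSqrt D
  have hdr : DenseRange r := denseRange_of_injective hr hi
  let ι := graphIncl D
  have hιι : ∀ x, ι (ContinuousLinearMap.adjoint ι x) = r (r x) := fun x =>
    congrArg (fun T : H →L[ℂ] H => T x) (oneAddSqInvSqrt_mul_self D).symm
  have hnorm : ∀ x, ‖ContinuousLinearMap.adjoint ι x‖ = ‖r x‖ := by
    intro x
    rw [← sq_eq_sq₀ (norm_nonneg _) (norm_nonneg _), ← inner_self_eq_norm_sq (𝕜 := ℂ),
      ← inner_self_eq_norm_sq (𝕜 := ℂ), ContinuousLinearMap.adjoint_inner_left, hιι,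
      ← ContinuousLinearMap.adjoint_inner_left, hrr]
  -- Polar decomposition `ι* = W r`: since `‖ι* x‖ = ‖r x‖`, the map `r x ↦ ι* x` extends from the
  -- dense range of `r` to an isometry `W`.
  let W : H →L[ℂ] graphSpace D :=
    (ContinuousLinearMap.adjoint ι).toLinearMap.extendOfNorm r.toLinearMap
  have hW : ∀ x, W (r x) = ContinuousLinearMap.adjoint ι x := fun x =>
    LinearMap.extendOfNorm_eq hdr ⟨1, fun x => by
      rw [one_mul]; exact (hnorm x).le⟩ x
  have hWr : W ∘L r = ContinuousLinearMap.adjoint ι := by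
    ext1 x
    exact hW x
  -- This shows that the range of `r` is all of `dom D`, not just a core.
  have hrW : r ∘L ContinuousLinearMap.adjoint W = ι := by
    have := congrArg ContinuousLinearMap.adjoint hWr
    rwa [ContinuousLinearMap.adjoint_comp, ContinuousLinearMap.adjoint_adjoint, hrr] at this
  have hιW : ∀ x, ι (W x) = r x := by
    refine fun x => congrFun (hdr.equalizer (ι ∘L W).continuous r.continuous ?_) x
    funext x
    exact (congrArg ι (hW x)).trans (hιι x)
  have hWW : ∀ x, ContinuousLinearMap.adjoint W (W x) = x := by
    intro x
    apply hi
    rw [← hιW x]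
    exact congrArg (fun T : graphSpace D →L[ℂ] H => T (W x)) hrW
  -- `W x = (r x, F x)` lies in the graph of `D`, so `D r = F`; that `W` is isometric reads `F*F +
  -- r² = 1`.
  let F : H →L[ℂ] H := (ContinuousLinearMap.snd ℂ H H) ∘L
    (WithLp.prodContinuousLinearEquiv 2 ℂ H H : WithLp 2 (H × H) →L[ℂ] H × H) ∘L
      (graphSpace D).subtypeL ∘L W
  refine ⟨F, fun x => ?_, fun y hy => ?_, ?_⟩
  · obtain ⟨z, hz1, hz2⟩ := (D.mem_graph_iff).1 ((mem_graphSpace hc (W x).1).1 (W x).2)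
    have hz : (z : H) = r x := hz1.trans (hιW x)
    obtain ⟨z, hzD⟩ := z
    change z = r x at hz
    subst hz
    exact ⟨hzD, hz2⟩
  · have hg : WithLp.toLp 2 (y, D ⟨y, hy⟩) ∈ graphSpace D :=
      (mem_graphSpace hc _).2 (D.mem_graph ⟨y, hy⟩)
    exact ⟨ContinuousLinearMap.adjoint W ⟨_, hg⟩,
      congrArg (fun T : graphSpace D →L[ℂ] H => T ⟨_, hg⟩) hrW⟩
  · ext x
    refine ext_inner_right ℂ fun y => ?_
    have h1 : ⟪W x, W y⟫_ℂ = ⟪r x, r y⟫_ℂ + ⟪F x, F y⟫_ℂ := by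
      rw [← hιW x, ← hιW y]
      exact WithLp.prod_inner_apply _ _
    have h2 : ⟪W x, W y⟫_ℂ = ⟪x, y⟫_ℂ := by
      rw [← ContinuousLinearMap.adjoint_inner_left, hWW]
    have h3 : ⟪r (r x), y⟫_ℂ = ⟪r x, r y⟫_ℂ := by
      rw [← ContinuousLinearMap.adjoint_inner_right, hrr]
    rw [add_apply, inner_add_left, mul_apply_eq_comp, mul_apply_eq_comp,
      ContinuousLinearMap.star_eq_adjoint, ContinuousLinearMap.adjoint_inner_left, h3, add_comm,
      ← h1, h2]
    rfl

variable {F : H →L[ℂ] H}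

theorem mul_eq_star_mul_of_symmetric (hsym : D.IsFormalAdjoint D)
    (hF : ∀ x, ∃ h : oneAddSqInvSqrt D x ∈ D.domain, D ⟨_, h⟩ = F x) :
    oneAddSqInvSqrt D * F = star F * oneAddSqInvSqrt D := by
  have hrr : ContinuousLinearMap.adjoint (oneAddSqInvSqrt D) = oneAddSqInvSqrt D :=
    star_oneAddSqInvSqrt D
  ext x
  refine ext_inner_right ℂ fun y => ?_
  obtain ⟨hx, hxF⟩ := hF x
  obtain ⟨hy, hyF⟩ := hF y
  rw [mul_apply_eq_comp, mul_apply_eq_comp, ContinuousLinearMap.star_eq_adjoint,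
    ContinuousLinearMap.adjoint_inner_left, ← ContinuousLinearMap.adjoint_inner_right, hrr, ← hxF,
    ← hyF]
  exact hsym ⟨_, hx⟩ ⟨_, hy⟩

/-- The witness is `D* s x = F* x`. Thus an operator that maps `dom D*` into `dom D` maps the range
of `s` into the range of `r`, which produces the operators `β` of `isCompactOperator_star_mul_sub`.
-/
theorem mem_adjoint_domain_of_intertwine {s : H →L[ℂ] H} (hs : 0 ≤ s)
    (hF : ∀ x, ∃ h : oneAddSqInvSqrt D x ∈ D.domain, D ⟨_, h⟩ = F x)
    (hran : ∀ y ∈ D.domain, ∃ x, oneAddSqInvSqrt D x = y)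
    (hrs : F * oneAddSqInvSqrt D = s * F) (x : H) : s x ∈ D.adjoint.domain := by
  have hrr := star_oneAddSqInvSqrt D
  have hss : star s = s := (IsSelfAdjoint.of_nonneg hs).star_eq
  have hrs' : oneAddSqInvSqrt D * star F = star F * s := by
    simpa [hrr, hss] using congrArg star hrs
  refine D.mem_adjoint_domain_of_exists _ ⟨star F x, ?_⟩
  rintro ⟨z, hz⟩
  obtain ⟨w, rfl⟩ := hran z hz
  obtain ⟨_, hw⟩ := hF w
  rw [hw]
  calc ⟪star F x, oneAddSqInvSqrt D w⟫_ℂ = ⟪(oneAddSqInvSqrt D * star F) x, w⟫_ℂ := by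
        rw [mul_apply_eq_comp, ← ContinuousLinearMap.adjoint_inner_right (oneAddSqInvSqrt D),
          ← ContinuousLinearMap.star_eq_adjoint, hrr]
    _ = ⟪s x, F w⟫_ℂ := by
        rw [hrs', mul_apply_eq_comp, ContinuousLinearMap.star_eq_adjoint,
          ContinuousLinearMap.adjoint_inner_left]

theorem eq_of_mul_eq_mul_of_injective {r S T : H →L[ℂ] H} (hi : Function.Injective r)
    (h : r * S = r * T) : S = T := by
  ext x
  exact hi (congrArg (fun U : H →L[ℂ] H => U x) h)

/-- If `γ` is a self-adjoint unitary that anticommutes with `D`, it anticommutes with the bounded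
transform. -/
theorem anticommute_boundedTransform (hc : D.IsClosed) (hd : Dense (D.domain : Set H))
    (hF : ∀ x, ∃ h : oneAddSqInvSqrt D x ∈ D.domain, D ⟨_, h⟩ = F x)
    (hran : ∀ y ∈ D.domain, ∃ x, oneAddSqInvSqrt D x = y)
    (hF1 : star F * F + oneAddSqInvSqrt D * oneAddSqInvSqrt D = 1)
    {γ : H →L[ℂ] H} (hγ : IsSelfAdjoint γ) (hγ2 : γ * γ = 1)
    (hodd : ∀ x : D.domain, ∃ hx : γ x ∈ D.domain, D ⟨γ x, hx⟩ = -γ (D x)) :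
    F * γ = -(γ * F) := by
  set r := oneAddSqInvSqrt D with hr_def
  have hr : 0 ≤ r := oneAddSqInvSqrt_nonneg D
  have hi : Function.Injective r := injective_oneAddSqInvSqrt hc hd
  have hrr : star r = r := star_oneAddSqInvSqrt D
  -- `c = r⁻¹ γ r`. Since `F c = -γ F`, the claim amounts to `c = γ`, that is, to `γ r = r γ`.
  obtain ⟨c, hc⟩ := exists_factor_of_range_le (S := γ * r) hi fun x => by
    obtain ⟨hx, -⟩ := hF x
    obtain ⟨hx', -⟩ := hodd ⟨r x, hx⟩
    exact hran _ hx'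
  have hFc : F * c = -(γ * F) := by
    ext x
    obtain ⟨hx, hxF⟩ := hF x
    obtain ⟨hx', hxo⟩ := hodd ⟨r x, hx⟩
    obtain ⟨hcx, hcF⟩ := hF (c x)
    have e : r (c x) = γ (r x) := congrArg (fun U : H →L[ℂ] H => U x) hc.symm
    calc F (c x) = D ⟨r (c x), hcx⟩ := hcF.symm
      _ = D ⟨γ (r x), hx'⟩ := by congr 1; exact Subtype.ext e
      _ = -γ (D ⟨r x, hx⟩) := hxo
      _ = _ := by rw [hxF]; rfl
  have hc' : r * γ = star c * r := by simpa [hrr, hγ.star_eq] using congrArg star hc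
  have hFc' : star c * star F = -(star F * γ) := by simpa [hγ.star_eq] using congrArg star hFc
  -- Insert `F*F + r² = 1` between the factors: `c* F* F c = F* γ² F` and `c* r² c = r γ² r`. An
  -- isometric involution is self-adjoint, so `γ` commutes with `r²`, and Sylvester uniqueness
  -- passes to `r`.
  have h1 : star c * c = 1 := by
    linear_combination (norm := noncomm_ring) -star c * hF1 * c + hFc' * F * c
      - star F * γ * hFc + star F * hγ2 * F + hF1 - hc' * r * c - r * γ * hc + r * hγ2 * r
  have h2 : c * c = 1 := by
    refine eq_of_mul_eq_mul_of_injective hi ?_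
    linear_combination (norm := noncomm_ring) -hc * c - γ * hc + hγ2 * r
  have h3 : star c = c := by
    linear_combination (norm := noncomm_ring) -star c * h2 + h1 * c
  rw [h3] at hc'
  have h4 : γ * r - r * γ = 0 := by
    refine eq_zero_of_sylvester hr hr hi ?_
    linear_combination (norm := noncomm_ring) hc * r - r * hc'
  have h5 : c = γ := by
    refine eq_of_mul_eq_mul_of_injective hi ?_
    linear_combination (norm := noncomm_ring) -hc + h4
  rw [← hFc, h5]

end UnboundedOperators

/-! ### From the axioms of a spectral triple to the relative `K`-cycle. -/

namespace RelKHom.IsHigherOrderRelativeSpectralTriple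

variable {A : Type*} [NonUnitalCStarAlgebra A] {J : TwoSidedIdeal A}
  {H : Type*} [NormedAddCommGroup H] [InnerProductSpace ℂ H] [CompleteSpace H]
  {p : Parity} {m : ℝ} {𝒥 𝒜 : NonUnitalStarSubalgebra ℂ A} {γ : H →L[ℂ] H}
  {ρ : A →⋆ₙₐ[ℂ] (H →L[ℂ] H)} {D : H →ₗ.[ℂ] H} {F : H →L[ℂ] H}

/-- Translates the axioms for `[D, ρ a]` into bounded operators: `F α - ρ a F` is `[D, ρ a] (1 +
D*D)^(-1/2)`. -/
theorem exists_conj (hD : IsHigherOrderRelativeSpectralTriple p m J 𝒥 𝒜 γ ρ D)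
    (hF : ∀ x, ∃ h : oneAddSqInvSqrt D x ∈ D.domain, D ⟨_, h⟩ = F x)
    (hran : ∀ y ∈ D.domain, ∃ x, oneAddSqInvSqrt D x = y) {a : A} (ha : a ∈ 𝒜) :
    ∃ α : H →L[ℂ] H, ρ a * oneAddSqInvSqrt D = oneAddSqInvSqrt D * α ∧
      IsCompactOperator (F * α - ρ a * F : H →L[ℂ] H) ∧
      InterpolationBound (oneAddSqInvSqrt D) (min 1 (1 / m)) (F * α - ρ a * F) := by
  set r := oneAddSqInvSqrt D with hr_def
  have hi : Function.Injective r := injective_oneAddSqInvSqrt hD.closed hD.dense_domain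
  have hR := oneAddSqInv_nonneg D
  have hm := hD.order_pos
  obtain ⟨α, hα⟩ := exists_factor_of_range_le (S := ρ a * r) hi fun x =>
    hran _ (hD.rep_domain a ha _ (hF x).1)
  have hcomm : ∀ x, ∃ h : r x ∈ (opCommutator D (ρ a)).domain,
      opCommutator D (ρ a) ⟨r x, h⟩ = (F * α - ρ a * F) x := by
    intro x
    obtain ⟨hx, hxF⟩ := hF x
    obtain ⟨hαx, hαF⟩ := hF (α x)
    have hax := hD.rep_domain a ha _ hx
    obtain ⟨h, he⟩ := opCommutator_apply D (ρ a) hx hax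
    refine ⟨h, ?_⟩
    have e : r (α x) = ρ a (r x) := congrArg (fun U : H →L[ℂ] H => U x) hα.symm
    have e2 : D ⟨ρ a (r x), hax⟩ = D ⟨r (α x), hαx⟩ := by congr 1; exact Subtype.ext e.symm
    rw [he, e2, hαF, hxF]
    rfl
  refine ⟨α, hα, ?_, ?_⟩
  · obtain ⟨K, hK, hKe⟩ := hD.compact_commutator a ha
    rw [oneAddSqPow_neg_half] at hKe
    have : F * α - ρ a * F = K := by
      ext x
      obtain ⟨h, he⟩ := hcomm x
      rw [← he]
      exact (apply_of_opMul_le hKe.le ⟨x, trivial⟩ h).symm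
    rwa [this]
  · obtain ⟨B, hB⟩ := hD.bounded_commutator a ha
    rcases le_or_gt (-(1 / 2) + 1 / (2 * m)) 0 with hs | hs
    -- Case `m ≥ 1`. With `R = (1 + D*D)⁻¹` one has `r = R^(1/2 - 1/(2m)) R^(1/(2m))`, so the
    -- commutator times `r` is `B R^(1/(2m))`.
    · rw [oneAddSqPow_of_nonpos D hs] at hB
      have e1 : 1 / (2 * m) = 1 / m / 2 := by field_simp
      rw [e1] at hs hB
      have hε : 1 / m ≤ 1 := by linarith
      rw [min_eq_right hε]
      refine ⟨‖B‖, norm_nonneg _, fun δ hδ x => ?_⟩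
      obtain ⟨h, he⟩ := hcomm x
      have hx : (oneAddSqInv D ^ (-(-(1 / 2) + 1 / m / 2)) : H →L[ℂ] H)
          ((oneAddSqInv D ^ (1 / m / 2) : H →L[ℂ] H) x) = r x := by
        rw [← mul_apply_eq_comp, rpow_mul_rpow hR (by linarith) (by positivity)]
        congr 2
        ring
      have h' := h
      rw [← hx] at h'
      have hBx := apply_of_opMul_le hB ⟨(oneAddSqInv D ^ (1 / m / 2) : H →L[ℂ] H) x, trivial⟩ h'
      have : (F * α - ρ a * F) x = B ((oneAddSqInv D ^ (1 / m / 2) : H →L[ℂ] H) x) := by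
        rw [hBx, ← he]
        congr 1
        exact Subtype.ext hx.symm
      rw [this, mul_assoc]
      exact B.le_of_opNorm_le_of_le le_rfl
        (norm_rpow_apply_le hR (one_div_pos.2 hm) hε hδ x)
    -- Case `m < 1`. The power is now an unbounded inverse, and the commutator times `r` is `B R^s
    -- r` with `s > 0`. It is dominated by `‖r x‖`, which is the bound for exponent `1`.
    · have e1 : 1 / (2 * m) = 1 / m / 2 := by field_simp
      have hε : 1 ≤ 1 / m := by rw [e1] at hs; linarith
      rw [min_eq_left hε]
      set s := -(1 / 2) + 1 / (2 * m)
      refine ⟨‖B‖ * ‖(oneAddSqInv D ^ s : H →L[ℂ] H)‖, by positivity, fun δ hδ x => ?_⟩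
      obtain ⟨h, he⟩ := hcomm x
      obtain ⟨hz, hzx⟩ := oneAddSqPow_apply_of_pos hD.closed hD.dense_domain hs (r x)
      have hBx := apply_of_opMul_le hB ⟨_, hz⟩
        (hzx.symm ▸ h : _ ∈ (opCommutator D (ρ a)).domain)
      have : (F * α - ρ a * F) x = B ((oneAddSqInv D ^ s : H →L[ℂ] H) (r x)) := by
        rw [hBx, ← he]
        congr 1
        exact Subtype.ext hzx.symm
      rw [this, Real.rpow_one]
      calc _ ≤ ‖B‖ * (‖(oneAddSqInv D ^ s : H →L[ℂ] H)‖ * ‖r x‖) :=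
            B.le_of_opNorm_le_of_le le_rfl (ContinuousLinearMap.le_opNorm _ _)
        _ = ‖B‖ * ‖(oneAddSqInv D ^ s : H →L[ℂ] H)‖ * δ * (δ⁻¹ * ‖r x‖) := by field_simp
        _ ≤ _ := by
          gcongr
          linarith [norm_nonneg x]

theorem compact_mul_oneAddSqInvSqrt (hD : IsHigherOrderRelativeSpectralTriple p m J 𝒥 𝒜 γ ρ D)
    {j : A} (hj : j ∈ 𝒥) : IsCompactOperator (ρ j * oneAddSqInvSqrt D : H →L[ℂ] H) := by
  obtain ⟨K, hK, hKe⟩ := hD.compact_resolvent j hj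
  rw [oneAddSqPow_neg_half] at hKe
  have : ρ j * oneAddSqInvSqrt D = K := by
    ext x
    exact (apply_of_opMul_le hKe.le ⟨x, trivial⟩ trivial).symm
  rwa [this]

theorem isRelativeKCycle (hD : IsHigherOrderRelativeSpectralTriple p m J 𝒥 𝒜 γ ρ D)
    (hF : ∀ x, ∃ h : oneAddSqInvSqrt D x ∈ D.domain, D ⟨_, h⟩ = F x)
    (hran : ∀ y ∈ D.domain, ∃ x, oneAddSqInvSqrt D x = y)
    (hF1 : star F * F + oneAddSqInvSqrt D * oneAddSqInvSqrt D = 1) :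
    IsRelativeKCycle p J γ ρ F := by
  have hr : 0 ≤ oneAddSqInvSqrt D := oneAddSqInvSqrt_nonneg D
  have hi : Function.Injective (oneAddSqInvSqrt D) :=
    injective_oneAddSqInvSqrt hD.closed hD.dense_domain
  have hrr := star_oneAddSqInvSqrt D
  have hε : 0 < min 1 (1 / m) := lt_min one_pos (one_div_pos.2 hD.order_pos)
  have hρ : Continuous ρ := AddMonoidHomClass.continuous_of_bound ρ 1 fun a => by
    simpa using NonUnitalStarAlgHom.norm_apply_le ρ a
  have hcomm : ∀ a ∈ 𝒜, IsCompactOperator (F * ρ a - ρ a * F : H →L[ℂ] H) := by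
    intro a ha
    obtain ⟨α, hα, hk, hb⟩ := hD.exists_conj hF hran ha
    obtain ⟨α', hα', hk', hb'⟩ := hD.exists_conj hF hran (star_mem ha)
    rw [map_star] at hα' hk' hb'
    exact isCompactOperator_commutator hr hi hε hF1 hα hα' hk hk' hb hb'
  obtain ⟨s, hs, hF2⟩ := exists_sqrt_one_sub_mul_star hF1 hr
  have hrs := intertwine_sqrt hr hs hi hF1 hF2
  have hsymm := mul_eq_star_mul_of_symmetric hD.symmetric hF
  have hβ : ∀ j ∈ 𝒥, ∃ β : H →L[ℂ] H, ρ j * s = oneAddSqInvSqrt D * β := fun j hj =>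
    exists_factor_of_range_le hi fun x => hran _ (hD.rep_adjoint_domain j hj _
      (mem_adjoint_domain_of_intertwine hs hF hran hrs x))
  have hstar : ∀ i ∈ 𝒥, ∀ j ∈ 𝒥,
      IsCompactOperator (star F * ρ (i * j) - ρ (i * j) * F : H →L[ℂ] H) := by
    intro i hi' j hj
    have hi𝒜 := hD.𝒥_le_𝒜 hi'
    have hj𝒜 := hD.𝒥_le_𝒜 hj
    obtain ⟨α₁, hα₁, hk₁, hb₁⟩ := hD.exists_conj hF hran hi𝒜
    obtain ⟨α₂, hα₂, hk₂, hb₂⟩ := hD.exists_conj hF hran (star_mem hj𝒜)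
    obtain ⟨α, hα, hk, hb⟩ := hD.exists_conj hF hran (mul_mem hi𝒜 hj𝒜)
    obtain ⟨β₁, hβ₁⟩ := hβ _ (star_mem hi')
    obtain ⟨β₂, hβ₂⟩ := hβ _ hj
    rw [map_star] at hα₂ hk₂ hb₂ hβ₁
    rw [map_mul] at hα hk hb ⊢
    exact isCompactOperator_star_mul_sub hr hs hi hε hF1 hF2 hrs hsymm hα₁ hα hα₂ hβ₁ hβ₂
      hk₁ hk₂ hk hb₁ hb₂ hb
  -- Products suffice: `(ρ(j) X)* (ρ(j) X) = X* ρ(j* j) X`, so the `C*`-identity passes from `j* j`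
  -- to `j`, and norm closure from `𝒥` to `J`.
  have hext : ∀ X : H →L[ℂ] H,
      (∀ j ∈ 𝒥, IsCompactOperator (ρ (star j * j) * X : H →L[ℂ] H)) →
      ∀ j ∈ J, IsCompactOperator (ρ j * X : H →L[ℂ] H) := by
    intro X hX j hj
    have hcl : IsClosed {x : A | IsCompactOperator (ρ x * X : H →L[ℂ] H)} :=
      (isClosed_setOfPred_isCompactOperator (σ₁₂ := RingHom.id ℂ) (M₁ := H) (M₂ := H)).preimage
        (hρ.mul continuous_const)
    refine hcl.closure_subset_iff.2 (fun x hx => ?_) (hD.dense_𝒥 hj)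
    refine isCompactOperator_of_star_mul_self ?_
    have e : star (ρ x * X) * (ρ x * X) = star X * (ρ (star x * x) * X) := by
      rw [star_mul, map_mul, map_star]
      simp only [mul_assoc]
    rw [e]
    exact (hX x hx).mul_left _
  refine ⟨hD.grading, hD.rep_even, ?_, ?_, ?_, ?_⟩
  · intro hp
    exact anticommute_boundedTransform hD.closed hD.dense_domain hF hran hF1
      hD.grading.selfAdjoint hD.grading.sq (hD.odd hp)
  · refine hext _ fun j hj => ?_
    have h1 := hstar _ (star_mem hj) _ hj
    have h2 := hcomm _ (hD.𝒥_le_𝒜 (mul_mem (star_mem hj) hj))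
    set u := star j * j with hu
    have hus : star (ρ u) = ρ u := by rw [← map_star, hu, star_mul, star_star]
    have e : ρ u * (F - star F) =
        star ((star F * ρ u - ρ u * F) - (F * ρ u - ρ u * F)) := by
      simp only [star_sub, star_mul, star_star, hus]
      noncomm_ring
    rw [e]
    exact (h1.sub h2).star
  · refine hext _ fun j hj => ?_
    have h1 := hstar _ (star_mem hj) _ hj
    have huJ := mul_mem (star_mem hj) hj
    have h2 := hcomm _ (hD.𝒥_le_𝒜 huJ)
    have h3 := (hD.compact_mul_oneAddSqInvSqrt huJ).star
    set u := star j * j with hu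
    have hus : star (ρ u) = ρ u := by rw [← map_star, hu, star_mul, star_star]
    rw [star_mul, hrr, hus] at h3
    -- Starting from `ρ u = (F*F + r²) ρ u`, the factor `F` and then `F*` is moved past `ρ u`, each
    -- time at the cost of a compact operator.
    have e : ρ u * (1 - F * F) = oneAddSqInvSqrt D * (oneAddSqInvSqrt D * ρ u) +
        star F * (F * ρ u - ρ u * F) + (star F * ρ u - ρ u * F) * F := by
      linear_combination (norm := noncomm_ring) -hF1 * ρ u
    rw [e]
    exact ((h3.mul_left _).add (h2.mul_left _)).add (h1.mul_right F)
  · intro a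
    have hcl : IsClosed {x : A | IsCompactOperator (F * ρ x - ρ x * F : H →L[ℂ] H)} :=
      (isClosed_setOfPred_isCompactOperator (σ₁₂ := RingHom.id ℂ) (M₁ := H) (M₂ := H)).preimage
        ((continuous_const.mul hρ).sub (hρ.mul continuous_const))
    exact hcl.closure_subset_iff.2 hcomm (hD.dense_𝒜 a)

theorem exists_isRelativeKCycle (hD : IsHigherOrderRelativeSpectralTriple p m J 𝒥 𝒜 γ ρ D) :
    ∃ F : H →L[ℂ] H, boundedTransform D = ofBounded F ∧ IsRelativeKCycle p J γ ρ F := by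
  obtain ⟨F, hF, hran, hF1⟩ := exists_boundedTransform hD.closed hD.dense_domain
  refine ⟨F, ?_, hD.isRelativeKCycle hF hran hF1⟩
  rw [boundedTransform, oneAddSqPow_neg_half]
  refine LinearPMap.ext ?_ ?_
  · ext x
    exact ⟨fun _ => trivial, fun _ => ⟨trivial, (hF x).1⟩⟩
  · intro x hx _
    exact (hF x).2

end RelKHom.IsHigherOrderRelativeSpectralTriple

theorem theorem3p4 {A : Type*} [NonUnitalCStarAlgebra A] (J : TwoSidedIdeal A)
    (hJ : IsClosed (J : Set A))
    {H : Type*} [NormedAddCommGroup H] [InnerProductSpace ℂ H] [CompleteSpace H]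
    [TopologicalSpace.SeparableSpace H]
    (p : Parity) (m : ℝ) (𝒥 𝒜 : NonUnitalStarSubalgebra ℂ A) (γ : H →L[ℂ] H)
    (ρ : A →⋆ₙₐ[ℂ] (H →L[ℂ] H)) (D : H →ₗ.[ℂ] H)
    (hD : IsHigherOrderRelativeSpectralTriple p m J 𝒥 𝒜 γ ρ D) :
    (∃ F : H →L[ℂ] H, boundedTransform D = ofBounded F ∧
      (∀ j ∈ J, IsCompactOperator (ρ j * (F - star F) : H →L[ℂ] H)) ∧
      (∀ j ∈ J, IsCompactOperator (ρ j * (1 - F * F) : H →L[ℂ] H)) ∧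
      (∀ a : A, IsCompactOperator (F * ρ a - ρ a * F : H →L[ℂ] H)) ∧
      IsRelativeKCycle p J γ ρ F) ∧
    ∃! c : RelativeKHomology p J, ∃ (F : H →L[ℂ] H) (hF : IsRelativeKCycle p J γ ρ F),
      boundedTransform D = ofBounded F ∧ c = hF.toCycle.toClass := by
  obtain ⟨F, hDF, hF⟩ := hD.exists_isRelativeKCycle
  refine ⟨⟨F, hDF, hF.compact_selfAdjoint, hF.compact_sq, hF.compact_commutator, hF⟩,
    hF.toCycle.toClass, ⟨F, hF, hDF, rfl⟩, ?_⟩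
  rintro c ⟨F', hF', hDF', rfl⟩
  obtain rfl : F' = F := ofBounded_injective (hDF'.symm.trans hDF)
  rfl
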